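/- Consider a Markov decision process with finite nonempty sets $\mathcal S,\mathcal A$ of states and actions, transition matrices $(P_a)_{a\in\mathcal A}$, reward function $\mathcal R:\mathcal S\times\mathcal A\to[0,1]$ and discount factor $\gamma\in(0,1)$, and let $\pi_b$ be a behavior policy with $\pi_b(a|s)>0$ for all $(s,a)$ such that the Markov chain of states $\{S_k\}$ induced by $\pi_b$ is irreducible and aperiodic. Then this chain has a unique stationary distribution $\kappa_b$, and there is a unique function $Q^*$ that is the $Q$-function of an optimal policy. Put $N_{\min}=\min_{(s,a)}\kappa_b(s)\pi_b(a|s)$, which is positive, and let $t_{\mathrm{mix}}=\min\{k\ge 0:\max_s\|P_{\pi_b}^k(s,\cdot)-\kappa_b\|_{\mathrm{TV}}\le 1/4\}$, where $P_{\pi_b}$ is the transition matrix of $\{S_k\}$. Let $\{(S_k,A_k)\}$ be a trajectory generated by $\pi_b$ from an arbitrary distribution of $S_0$, and let $\{Q_k\}$ be the iterates of asynchronous $Q$-learning with constant stepsize $\alpha$ along it: $$Q_{k+1}(s,a)=Q_k(s,a)+\alpha\Big(\mathcal R(S_k,A_k)+\gamma\max_{a'}Q_k(S_{k+1},a')-Q_k(S_k,A_k)\Big)\quad\text{if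 }(s,a)=(S_k,A_k),$$ and $Q_{k+1}(s,a)=Q_k(s,a)$ otherwise. A number of samples of order $O(\log^2(1/\epsilon)/\epsilon^2)\,\tilde O((1-\gamma)^{-5})\,\tilde O(N_{\min}^{-3})$ suffices for $\mathbb E\|Q_k-Q^*\|_\infty\le\epsilon$, in the following sense. There is a universal $m\in\mathbb N$, and for all $T\in\mathbb N$, $B\in\mathbb R$ there is a constant $C>0$ depending only on $T$ and $B$, such that for every such process and policy with $t_{\mathrm{mix}}\le T$ and every $\epsilon>0$ there is a stepsize $\alpha\in(0,1)$ with the following property: for every $Q_0$ with $\|Q_0\|_\infty\le B/(1-\gamma)$, every such trajectory and every integer $k\ge0$ with $$k\;\ge\;C\cdot\frac{\max\{1,\log(1/\epsilon)\}^2}{\epsilon^2}\cdot\frac{\big(1+\log\frac1{1-\gamma}\big)^m}{(1-\gamma)^5}\cdot\frac{\big(1+\log\frac1{N_{\min}}\big)^m}{N_{\min}^3}$$ one has $\mathbb E\big[\|Q_k-Q^*\|_\infty\big]\le\epsilon$. -/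

import Mathlib

open MeasureTheory ProbabilityTheory
open scoped BigOperators

noncomputable section

namespace QLearning

/-! ### Finite Markov chains given by a transition matrix -/

/-- `κ` is a stationary distribution of the chain with transition matrix `P`. -/
structure IsStationary {S : Type*} [Fintype S] (P : Matrix S S ℝ) (κ : S → ℝ) : Prop where
  nonneg : ∀ s, 0 ≤ κ s
  sum_eq_one : ∑ s, κ s = 1
  invariant : ∀ s', ∑ s, κ s * P s s' = κ s'

/-- Every state has period one: `1` is the only common divisor of its possible return times. -/
def IsAperiodic {S : Type*} [Fintype S] [DecidableEq S] (P : Matrix S S ℝ) : Prop :=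
  ∀ s : S, ∀ d : ℕ, (∀ k : ℕ, 0 < k → 0 < (P ^ k) s s → d ∣ k) → d = 1

/-- `N_min = min_{(s, a)} κ(s) π(a | s)`. -/
def minVisit {S A : Type*} (κ : S → ℝ) (π : S → A → ℝ) : ℝ :=
  ⨅ x : S × A, κ x.1 * π x.1 x.2

/-- Total variation distance of two distributions on a finite set. -/
def tvDist {S : Type*} [Fintype S] (p q : S → ℝ) : ℝ :=
  (∑ s, |p s - q s|) / 2

/-- The mixing time with precision `δ`:
`min {k ≥ 0 : max_s ‖P ^ k (s, ·) - κ‖_TV ≤ δ}`. -/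
def mixingTime {S : Type*} [Fintype S] [DecidableEq S] (P : Matrix S S ℝ) (κ : S → ℝ)
    (δ : ℝ) : ℕ :=
  sInf {k : ℕ | ∀ s, tvDist ((P ^ k) s) κ ≤ δ}

/-! ### Markov decision processes and policies -/

/-- A discounted Markov decision process on finite sets of states and actions, with
transition matrices `P a`, rewards in `[0, 1]` and discount factor in `(0, 1)`. -/
structure MDP (S A : Type*) [Fintype S] where
  P : A → Matrix S S ℝ
  P_nonneg : ∀ a s s', 0 ≤ P a s s'
  P_sum : ∀ a s, ∑ s', P a s s' = 1
  R : S × A → ℝ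
  R_nonneg : ∀ x, 0 ≤ R x
  R_le_one : ∀ x, R x ≤ 1
  γ : ℝ
  γ_pos : 0 < γ
  γ_lt_one : γ < 1

/-- A (stationary, randomized) policy: `π s a` is the probability of the action `a` in the
state `s`. -/
structure Policy (S A : Type*) [Fintype A] where
  prob : S → A → ℝ
  nonneg : ∀ s a, 0 ≤ prob s a
  sum_eq_one : ∀ s, ∑ a, prob s a = 1

instance {S A : Type*} [Fintype A] : CoeFun (Policy S A) (fun _ => S → A → ℝ) :=
  ⟨Policy.prob⟩

section Values

variable {S A : Type*} [Fintype S] [Fintype A]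

/-- Transition matrix of the chain of states induced by the policy `π`. -/
def MDP.stateChain (M : MDP S A) (π : Policy S A) : Matrix S S ℝ :=
  Matrix.of fun s s' => ∑ a, π s a * M.P a s s'

variable [MeasurableSpace S] [MeasurableSpace A]

/-- Law of `(S_{k+1}, A_{k+1})` given `(S_k, A_k) = x` under the policy `π`. -/
def MDP.stepMeasure (M : MDP S A) (π : Policy S A) (x : S × A) : Measure (S × A) :=
  ∑ y : S × A, ENNReal.ofReal (M.P x.2 x.1 y.1 * π y.1 y.2) • Measure.dirac y

theorem MDP.isProbabilityMeasure_stepMeasure (M : MDP S A) (π : Policy S A) (x : S × A) :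
    IsProbabilityMeasure (M.stepMeasure π x) := by
  constructor
  simp only [MDP.stepMeasure, Measure.coe_finsetSum, Finset.sum_apply, Measure.smul_apply,
    measure_univ, smul_eq_mul, mul_one]
  rw [← ENNReal.ofReal_sum_of_nonneg
    (fun y _ => mul_nonneg (M.P_nonneg _ _ _) (π.nonneg _ _)), Fintype.sum_prod_type]
  simp [← Finset.mul_sum, π.sum_eq_one, M.P_sum]

variable [DiscreteMeasurableSpace S] [DiscreteMeasurableSpace A]

/-- Transition kernel of the chain `(S_k, A_k)` under the policy `π`. -/
def MDP.stepKernel (M : MDP S A) (π : Policy S A) : Kernel (S × A) (S × A) where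
  toFun := M.stepMeasure π
  measurable' := measurable_of_countable _

instance (M : MDP S A) (π : Policy S A) : IsMarkovKernel (M.stepKernel π) :=
  ⟨fun x => M.isProbabilityMeasure_stepMeasure π x⟩

/-- The same kernel, seen as a kernel from the whole past: it only looks at the last pair. -/
def MDP.historyKernel (M : MDP S A) (π : Policy S A) (n : ℕ) :
    Kernel (Π _ : Finset.Iic n, S × A) (S × A) :=
  (M.stepKernel π).comap (fun h => h ⟨n, Finset.mem_Iic.2 le_rfl⟩) (measurable_pi_apply _)

instance (M : MDP S A) (π : Policy S A) (n : ℕ) : IsMarkovKernel (M.historyKernel π n) := by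
  unfold MDP.historyKernel
  infer_instance

/-- Law of the trajectory `(S_0, A_0), (S_1, A_1), …` generated by `π`, when `(S_0, A_0)` has
law `μ₀`. -/
def MDP.trajectoryLaw (M : MDP S A) (π : Policy S A) (μ₀ : Measure (S × A)) :
    Measure (ℕ → S × A) :=
  Kernel.trajMeasure (X := fun _ => S × A) μ₀ (fun n => M.historyKernel π n)

/-- The discounted cumulative reward `∑ₖ γᵏ R(S_k, A_k)` along a trajectory. -/
def MDP.discountedReturn (M : MDP S A) (z : ℕ → S × A) : ℝ :=
  ∑' k, M.γ ^ k * M.R (z k)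

/-- The `Q`-function of `π`: expected return given `S_0 = s`, `A_0 = a`. -/
def MDP.Qfun (M : MDP S A) (π : Policy S A) (x : S × A) : ℝ :=
  ∫ z, M.discountedReturn z ∂(M.trajectoryLaw π (Measure.dirac x))

/-- The value function of `π`: expected return given `S_0 = s`, all actions being drawn from
`π`. -/
def MDP.Vfun (M : MDP S A) (π : Policy S A) (s : S) : ℝ :=
  ∫ z, M.discountedReturn z
    ∂(M.trajectoryLaw π (∑ a, ENNReal.ofReal (π s a) • Measure.dirac (s, a)))

/-- `π` is an optimal policy. -/
def MDP.IsOptimal (M : MDP S A) (π : Policy S A) : Prop :=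
  ∀ (π' : Policy S A) (s : S), M.Vfun π' s ≤ M.Vfun π s

/-- `Qs` is the optimal `Q`-function, that is, the `Q`-function of an optimal policy. -/
def MDP.IsOptimalQ (M : MDP S A) (Qs : S × A → ℝ) : Prop :=
  ∃ π : Policy S A, M.IsOptimal π ∧ M.Qfun π = Qs

end Values

/-! ### Sample trajectories and asynchronous `Q`-learning -/

/-- `Z k = (S_k, A_k)` is a sample trajectory of `M` under the policy `π`, started from an
arbitrary distribution of `S_0`: `A_k` is drawn from `π (S_k, ·)` and `S_{k+1}` from
`P_{A_k} (S_k, ·)`. This is said through the finite-dimensional distributions. -/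
structure IsTrajectory {S A Ω : Type*} [Fintype S] [Fintype A] [MeasurableSpace S]
    [MeasurableSpace A] [MeasurableSpace Ω] (M : MDP S A) (π : Policy S A)
    (μ : Measure Ω) (Z : ℕ → Ω → S × A) : Prop where
  measurable : ∀ k, Measurable (Z k)
  law : ∀ (n : ℕ) (z : ℕ → S × A),
    μ.real {ω | ∀ i ≤ n, Z i ω = z i} =
      μ.real {ω | (Z 0 ω).1 = (z 0).1} * π (z 0).1 (z 0).2 *
        ∏ i ∈ Finset.range n,
          (M.P (z i).2 (z i).1 (z (i + 1)).1 * π (z (i + 1)).1 (z (i + 1)).2)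

/-- Temporal difference
`R(s₀, a₀) + γ max_{a'} Q(s₁, a') - Q(s₀, a₀)`, with `x = (s₀, a₀)`. -/
def MDP.temporalDifference {S A : Type*} [Fintype S] (M : MDP S A) (Q : S × A → ℝ)
    (x : S × A) (s₁ : S) : ℝ :=
  M.R x + M.γ * (⨆ a', Q (s₁, a')) - Q x

/-- The iterates `Q_k` of asynchronous `Q`-learning with stepsizes `α`, started at `Q₀` and run
along the trajectory `z k = (S_k, A_k)`: in step `k` only the entry `(S_k, A_k)` changes.
The iterate `Q_k` uses the `k` samples `(S_i, A_i, S_{i+1})`, `i < k`. -/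
def MDP.qIterate {S A : Type*} [Fintype S] [DecidableEq S] [DecidableEq A] (M : MDP S A)
    (α : ℕ → ℝ) (Q₀ : S × A → ℝ) (z : ℕ → S × A) : ℕ → S × A → ℝ
  | 0 => Q₀
  | k + 1 => fun x =>
      if x = z k then
        M.qIterate α Q₀ z k x
          + α k * M.temporalDifference (M.qIterate α Q₀ z k) (z k) (z (k + 1)).1
      else M.qIterate α Q₀ z k x

end QLearning

end

/-! Write `g = 1 - γ`, `N = N_min`, `V* = max_a Q*(·, a)`. The analysis is pathwise first and starts
at an arbitrary time `t`. The noise is taken at `Q*`, namely `γ (V*(s') - P V*(x))`, not at `Q_k`: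
it is then centred given the past and bounded by `1 / g`, while the difference between `max Q_k` and
`V*` is absorbed by the `γ`-contraction. If `W_n` is the exponentially weighted average of this
noise at each pair, then `‖Q_{t+K} - Q*‖ ≤ ‖u_K‖ + max_{n ≤ K} ‖W_n‖ / g`
(`MDP.norm_qIterate_sub_le`), where the comparison process `u` depends only on the visited pairs.

The process `u`: over a block of steps an entry `x` drops to at most `(decay of x) + γ` times the
norm at the start. By mixing, every pair is visited at the end of any `O(T log(1 / N))` steps with
conditional probability at least `N / 2` (`MDP.minVisit_le_iterate_indicator`), so `m` such blocks
have expected decay at most `(1 - α N / 2) ^ m`. Summing over at most `1 / N` pairs, a phase of `m`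
blocks contracts `E‖u‖` by `(1 + γ) / 2`, and `k` phases bring it below `ε / 2`
(`IsTrajectory.integral_norm_errorBound_le`).

The averages `W`: only the visited entry changes, and by Hoeffding's lemma and convexity of `exp`
one step increases `E ∑_x exp(θ W(x))` by at most `α e^l`, whatever the visiting pattern. A union
over times, pairs and signs and Jensen's inequality bound `E max ‖W_n‖` by `(l + log(poly K)) / θ`
(`IsTrajectory.integral_norm_qIterate_sub_le`). The choices `α = ε² g⁴ / (8 l)` and `θ = 4 l / (ε
g)` make this term `ε / 2` once `l` dominates the logarithm; `exists_parameters` resolves the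
circular dependence of `K` and `l`.

All iterates lie in a fixed ball, so for any `k ≥ K` one starts at `t = k - K`. The resulting `K` is
of order `1 / N` up to logarithms, which is stronger than the required `1 / N ^ 3`. -/

noncomputable section

namespace QLearning

/-! ### Stochastic matrices -/

section Chain

variable {S : Type*} [Fintype S]

/-- Row-stochastic matrices. -/
structure IsStochastic (P : Matrix S S ℝ) : Prop where
  nonneg : ∀ s s', 0 ≤ P s s'
  sum_eq_one : ∀ s, ∑ s', P s s' = 1

theorem IsStochastic.mul {P Q : Matrix S S ℝ} (hP : IsStochastic P) (hQ : IsStochastic Q) :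
    IsStochastic (P * Q) := by
  refine ⟨fun s s' => ?_, fun s => ?_⟩
  · rw [Matrix.mul_apply]
    exact Finset.sum_nonneg fun u _ => mul_nonneg (hP.nonneg _ _) (hQ.nonneg _ _)
  · simp_rw [Matrix.mul_apply]
    rw [Finset.sum_comm]
    simp_rw [← Finset.mul_sum, hQ.sum_eq_one, mul_one, hP.sum_eq_one]

theorem IsStochastic.pow [DecidableEq S] {P : Matrix S S ℝ} (hP : IsStochastic P) (n : ℕ) :
    IsStochastic (P ^ n) := by
  induction n with
  | zero =>
    refine ⟨fun s s' => ?_, fun s => ?_⟩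
    · rw [pow_zero, Matrix.one_apply]; split_ifs <;> norm_num
    · simp [Matrix.one_apply]
  | succ n ih => rw [pow_succ]; exact ih.mul hP

/-- The oscillation of `f` is at most `d`. -/
def OscLE (f : S → ℝ) (d : ℝ) : Prop := ∀ s s', f s - f s' ≤ d

theorem sum_mul_sub_le_of_oscLE {p : S → ℝ} (hp : ∀ s, 0 ≤ p s) (h1 : ∑ s, p s = 1)
    {f : S → ℝ} {d : ℝ} (hf : OscLE f d) (s' : S) :
    |∑ s, p s * f s - f s'| ≤ d := by
  have : ∑ s, p s * f s - f s' = ∑ s, p s * (f s - f s') := by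
    simp_rw [mul_sub, Finset.sum_sub_distrib, ← Finset.sum_mul, h1, one_mul]
  rw [this]
  calc |∑ s, p s * (f s - f s')| ≤ ∑ s, |p s * (f s - f s')| := Finset.abs_sum_le_sum_abs _ _
    _ ≤ ∑ s, p s * d := by
        refine Finset.sum_le_sum fun s _ => ?_
        rw [abs_mul, abs_of_nonneg (hp s)]
        exact mul_le_mul_of_nonneg_left (abs_le.2 ⟨by linarith [hf s' s], hf s s'⟩) (hp s)
    _ = d := by rw [← Finset.sum_mul, h1, one_mul]

/-- Dobrushin contraction. Both rows have mass one, so `f` may be recentred at the midpoint `m` of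
its range; `|f - m| ≤ d / 2` then matches the `1 / 2` in `tvDist`. -/
theorem OscLE.mulVec_of_tvDist [Nonempty S] {P : Matrix S S ℝ} (hP : IsStochastic P)
    {c : ℝ} (hc : ∀ s s', tvDist (P s) (P s') ≤ c) {f : S → ℝ} {d : ℝ} (hf : OscLE f d) :
    OscLE (P.mulVec f) (c * d) := by
  intro s s'
  obtain ⟨a, ha⟩ := Finite.exists_max f
  obtain ⟨b, hb⟩ := Finite.exists_min f
  have hd : 0 ≤ d := by simpa using hf a a
  set m := (f a + f b) / 2
  have hm : ∀ u, |f u - m| ≤ d / 2 := fun u => by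
    have := hf a b
    refine abs_le.2 ⟨?_, ?_⟩ <;> simp only [m] <;> linarith [ha u, hb u]
  have key : P.mulVec f s - P.mulVec f s' = ∑ u, (P s u - P s' u) * (f u - m) := by
    simp_rw [Matrix.mulVec, dotProduct, mul_sub, Finset.sum_sub_distrib, ← Finset.sum_mul,
      sub_mul, Finset.sum_sub_distrib, hP.sum_eq_one]
    ring
  rw [key]
  calc ∑ u, (P s u - P s' u) * (f u - m) ≤ ∑ u, |P s u - P s' u| * (d / 2) := by
        refine Finset.sum_le_sum fun u _ => (le_abs_self _).trans ?_
        rw [abs_mul]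
        exact mul_le_mul_of_nonneg_left (hm u) (abs_nonneg _)
    _ = tvDist (P s) (P s') * d := by rw [← Finset.sum_mul, tvDist]; ring
    _ ≤ c * d := mul_le_mul_of_nonneg_right (hc s s') hd

theorem OscLE.mulVec {P : Matrix S S ℝ} (hP : IsStochastic P) {f : S → ℝ} {d : ℝ}
    (hf : OscLE f d) : OscLE (P.mulVec f) d := by
  have hle : ∀ s, ∀ u, P.mulVec f s - f u ≤ d := fun s u =>
    (le_abs_self _).trans (sum_mul_sub_le_of_oscLE (hP.nonneg s) (hP.sum_eq_one s) hf u)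
  intro s s'
  have h2 : ∑ u, P s' u * (P.mulVec f s - f u) ≤ ∑ u, P s' u * d :=
    Finset.sum_le_sum fun u _ => mul_le_mul_of_nonneg_left (hle s u) (hP.nonneg _ _)
  simp_rw [mul_sub, Finset.sum_sub_distrib, ← Finset.sum_mul, hP.sum_eq_one, one_mul] at h2
  exact h2

theorem tvDist_triangle_right (p q r : S → ℝ) : tvDist p q ≤ tvDist p r + tvDist q r := by
  have : ∑ s, |p s - q s| ≤ ∑ s, (|p s - r s| + |q s - r s|) :=
    Finset.sum_le_sum fun s _ => by
      rw [abs_sub_comm (q s)]; exact abs_sub_le _ _ _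
  rw [Finset.sum_add_distrib] at this
  simp only [tvDist]
  linarith

variable [DecidableEq S]

theorem OscLE.pow_mulVec [Nonempty S] {P : Matrix S S ℝ} (hP : IsStochastic P) {t : ℕ}
    {c : ℝ} (hc : ∀ s s', tvDist ((P ^ t) s) ((P ^ t) s') ≤ c) {f : S → ℝ} {d : ℝ}
    (hf : OscLE f d) {n j : ℕ} (hn : t * j ≤ n) : OscLE ((P ^ n).mulVec f) (c ^ j * d) := by
  have h1 : ∀ j : ℕ, OscLE ((P ^ (t * j)).mulVec f) (c ^ j * d) := fun j => by
    induction j with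
    | zero => simpa using hf
    | succ j ih =>
      rw [mul_add, mul_one, add_comm, pow_add, ← Matrix.mulVec_mulVec, pow_succ', mul_assoc]
      exact ih.mulVec_of_tvDist (hP.pow t) hc
  obtain ⟨r, rfl⟩ := Nat.exists_eq_add_of_le hn
  rw [add_comm, pow_add, ← Matrix.mulVec_mulVec]
  exact (h1 j).mulVec (hP.pow r)

theorem pow_mulVec_single (P : Matrix S S ℝ) (n : ℕ) (u : S) :
    (P ^ n).mulVec (Pi.single u 1) = fun s => (P ^ n) s u := by
  ext s; simp

theorem oscLE_single {S : Type*} [DecidableEq S] (u : S) : OscLE (Pi.single u (1 : ℝ)) 1 := by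
  intro s s'
  simp only [Pi.single_apply]
  split_ifs <;> norm_num

theorem IsStationary.pow {P : Matrix S S ℝ} {κ : S → ℝ} (hκ : IsStationary P κ) (n : ℕ) (u : S) :
    ∑ s, κ s * (P ^ n) s u = κ u := by
  induction n generalizing u with
  | zero => simp [Matrix.one_apply]
  | succ n ih =>
    simp_rw [pow_succ, Matrix.mul_apply, Finset.mul_sum]
    rw [Finset.sum_comm]
    simp_rw [← mul_assoc, ← Finset.sum_mul, ih]
    exact hκ.invariant u

/-- By stationarity `κ u` is a weighted average of the column `u` of `P ^ n`, and that column has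
oscillation at most `c ^ j`. -/
theorem IsStationary.abs_pow_sub_le [Nonempty S] {P : Matrix S S ℝ} (hP : IsStochastic P)
    {κ : S → ℝ} (hκ : IsStationary P κ) {t : ℕ} {c : ℝ}
    (hc : ∀ s s', tvDist ((P ^ t) s) ((P ^ t) s') ≤ c) {n j : ℕ} (hn : t * j ≤ n) (s u : S) :
    |(P ^ n) s u - κ u| ≤ c ^ j := by
  have h := (oscLE_single u).pow_mulVec hP hc hn
  rw [pow_mulVec_single, mul_one] at h
  have := sum_mul_sub_le_of_oscLE hκ.nonneg hκ.sum_eq_one h s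
  rwa [hκ.pow, abs_sub_comm] at this

/-- Some power of an irreducible and aperiodic matrix is positive. -/
theorem exists_pow_pos {P : Matrix S S ℝ} (hirr : P.IsIrreducible) (hap : IsAperiodic P) :
    ∃ N : ℕ, ∀ i j, 0 < (P ^ N) i j := by
  have hnn : ∀ n i j, 0 ≤ (P ^ n) i j := fun n i j => Matrix.pow_apply_nonneg hirr.nonneg n i j
  have hmul : ∀ {a b : ℕ} {i j k : S}, 0 < (P ^ a) i j → 0 < (P ^ b) j k →
      0 < (P ^ (a + b)) i k := by
    intro a b i j k h1 h2
    rw [pow_add, Matrix.mul_apply]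
    exact (mul_pos h1 h2).trans_le (Finset.single_le_sum
      (f := fun l => (P ^ a) i l * (P ^ b) l k)
      (fun l _ => mul_nonneg (hnn a i l) (hnn b l k)) (Finset.mem_univ j))
  have hret : ∀ s, ∃ n, ∀ m ≥ n, 0 < (P ^ m) s s := by
    intro s
    let G : Set ℕ := {k | 0 < k ∧ 0 < (P ^ k) s s}
    -- Aperiodicity makes the gcd of the return times one, so all large integers lie in the additive
    -- submonoid they generate; return times are closed under addition.
    have hg : Nat.setGcd G = 1 := by
      refine hap s _ fun k h0 hk => Nat.setGcd_dvd_of_mem ⟨h0, hk⟩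
    obtain ⟨n, hn⟩ := Nat.exists_mem_closure_of_ge G
    refine ⟨n, fun m hm => ?_⟩
    have := hn m hm (by simp [hg])
    clear hm
    induction this using AddSubmonoid.closure_induction with
    | mem x hx => exact hx.2
    | zero => simp
    | add x y _ _ hx hy => exact hmul hx hy
  choose n hn using hret
  choose k hk0 hk using (Matrix.isIrreducible_iff_exists_pow_pos hirr.nonneg).1 hirr
  refine ⟨Finset.univ.sup fun x : S × S => n x.1 + k x.1 x.2, fun i j => ?_⟩
  have hle : n i + k i j ≤ Finset.univ.sup fun x : S × S => n x.1 + k x.1 x.2 :=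
    Finset.le_sup (f := fun x : S × S => n x.1 + k x.1 x.2) (Finset.mem_univ (i, j))
  obtain ⟨r, hr⟩ := Nat.exists_eq_add_of_le hle
  rw [hr, show n i + k i j + r = (n i + r) + k i j by ring]
  exact hmul (hn i _ (by omega)) (hk i j)

/-- Doeblin's argument: if all entries of a positive power are at least `δ > 0`, then `|x - y| ≤ x +
y - 2 δ` entrywise, and summing leaves total variation at most `1 - δ`. -/
theorem exists_tvDist_le [Nonempty S] {P : Matrix S S ℝ} (hP : IsStochastic P)
    (hirr : P.IsIrreducible) (hap : IsAperiodic P) :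
    ∃ N : ℕ, ∃ c : ℝ, 0 ≤ c ∧ c < 1 ∧ ∀ s s', tvDist ((P ^ N) s) ((P ^ N) s') ≤ c := by
  obtain ⟨N, hN⟩ := exists_pow_pos hirr hap
  obtain ⟨⟨a, b⟩, hab⟩ := Finite.exists_min fun x : S × S => (P ^ N) x.1 x.2
  have hstoch := hP.pow N
  have hle : ∀ s s', tvDist ((P ^ N) s) ((P ^ N) s') ≤ 1 - (P ^ N) a b := by
    intro s s'
    have h1 : ∑ u, |(P ^ N) s u - (P ^ N) s' u| ≤
        ∑ u, ((P ^ N) s u + (P ^ N) s' u - 2 * (P ^ N) a b) := by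
      refine Finset.sum_le_sum fun u _ => ?_
      have h1 := hab (s, u)
      have h2 := hab (s', u)
      simp only at h1 h2
      exact abs_le.2 ⟨by linarith, by linarith⟩
    rw [Finset.sum_sub_distrib, Finset.sum_add_distrib, hstoch.sum_eq_one, hstoch.sum_eq_one,
      Finset.sum_const, nsmul_eq_mul] at h1
    have h2 : (1 : ℝ) ≤ (Finset.univ : Finset S).card := by
      exact_mod_cast Finset.card_pos.2 Finset.univ_nonempty
    have h3 := mul_le_mul_of_nonneg_right h2 (hN a b).le
    rw [tvDist]
    linarith
  refine ⟨N, 1 - (P ^ N) a b, ?_, by linarith [hN a b], hle⟩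
  obtain ⟨s⟩ := ‹Nonempty S›
  refine le_trans ?_ (hle s s)
  simp [tvDist]

/-- The divisor is `N + 1` because `N` may be zero. -/
theorem tendsto_pow_div {N : ℕ} {c : ℝ} (h0 : 0 ≤ c) (h1 : c < 1) :
    Filter.Tendsto (fun n : ℕ => c ^ (n / (N + 1))) Filter.atTop (nhds 0) :=
  (tendsto_pow_atTop_nhds_zero_of_lt_one h0 h1).comp (Nat.tendsto_div_const_atTop (by omega))

/-- Convergence theorem for irreducible aperiodic chains. -/
theorem exists_tendsto_pow [Nonempty S] {P : Matrix S S ℝ} (hP : IsStochastic P)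
    (hirr : P.IsIrreducible) (hap : IsAperiodic P) :
    ∃ κ : S → ℝ, ∀ s u, Filter.Tendsto (fun n => (P ^ n) s u) Filter.atTop (nhds (κ u)) := by
  obtain ⟨N, c, hc0, hc1, hc⟩ := exists_tvDist_le hP hirr hap
  have hosc : ∀ n u, OscLE (fun s => (P ^ n) s u) (c ^ (n / (N + 1))) := by
    intro n u
    have h := (oscLE_single u).pow_mulVec hP hc (n := n) (j := n / (N + 1))
      (le_trans (Nat.mul_le_mul_right _ (Nat.le_succ N)) (Nat.mul_div_le n (N + 1)))
    rwa [pow_mulVec_single, mul_one] at h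
  have hb := tendsto_pow_div (N := N) hc0 hc1
  have hdist : ∀ s s' u n m, |(P ^ (n + m)) s u - (P ^ n) s' u| ≤ c ^ (n / (N + 1)) := by
    intro s s' u n m
    rw [add_comm, pow_add, Matrix.mul_apply]
    exact sum_mul_sub_le_of_oscLE ((hP.pow m).nonneg s) ((hP.pow m).sum_eq_one s) (hosc n u) s'
  obtain ⟨s₀⟩ := ‹Nonempty S›
  have hcau : ∀ u, CauchySeq fun n => (P ^ n) s₀ u := fun u => by
    refine cauchySeq_of_le_tendsto_0' _ (fun n m hnm => ?_) hb
    obtain ⟨r, rfl⟩ := Nat.exists_eq_add_of_le hnm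
    rw [dist_comm, Real.dist_eq]
    exact hdist s₀ s₀ u n r
  choose κ hκ using fun u => cauchySeq_tendsto_of_complete (hcau u)
  refine ⟨κ, fun s u => ?_⟩
  have hz : Filter.Tendsto (fun n => (P ^ n) s u - (P ^ n) s₀ u) Filter.atTop (nhds 0) :=
    squeeze_zero_norm (fun n => by simpa using hdist s s₀ u n 0) hb
  simpa using hz.add (hκ u)

theorem isStationary_of_tendsto [Nonempty S] {P : Matrix S S ℝ} (hP : IsStochastic P) {κ : S → ℝ}
    (h : ∀ s u, Filter.Tendsto (fun n => (P ^ n) s u) Filter.atTop (nhds (κ u))) :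
    IsStationary P κ := by
  obtain ⟨s₀⟩ := ‹Nonempty S›
  refine ⟨fun u => ge_of_tendsto' (h s₀ u) fun n => (hP.pow n).nonneg _ _, ?_, fun u => ?_⟩
  · have h1 := tendsto_finsetSum Finset.univ fun u _ => h s₀ u
    simp_rw [fun n => (hP.pow n).sum_eq_one] at h1
    exact tendsto_nhds_unique tendsto_const_nhds h1 |>.symm
  · have h1 := tendsto_finsetSum Finset.univ fun v _ => (h s₀ v).mul_const (P v u)
    have h2 := (Filter.tendsto_add_atTop_iff_nat 1).2 (h s₀ u)
    simp_rw [pow_succ, Matrix.mul_apply] at h2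
    exact tendsto_nhds_unique h1 h2

theorem IsStationary.eq_of_tendsto {P : Matrix S S ℝ} {κ κ' : S → ℝ} (hκ' : IsStationary P κ')
    (h : ∀ s u, Filter.Tendsto (fun n => (P ^ n) s u) Filter.atTop (nhds (κ u))) : κ' = κ := by
  ext u
  have h1 := tendsto_finsetSum Finset.univ fun s _ => (h s u).const_mul (κ' s)
  simp_rw [hκ'.pow, ← Finset.sum_mul, hκ'.sum_eq_one, one_mul] at h1
  exact tendsto_nhds_unique tendsto_const_nhds h1

theorem existsUnique_isStationary [Nonempty S] {P : Matrix S S ℝ} (hP : IsStochastic P)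
    (hirr : P.IsIrreducible) (hap : IsAperiodic P) : ∃! κ : S → ℝ, IsStationary P κ := by
  obtain ⟨κ, hκ⟩ := exists_tendsto_pow hP hirr hap
  exact ⟨κ, isStationary_of_tendsto hP hκ, fun κ' h => h.eq_of_tendsto hκ⟩

theorem IsStationary.pos [Nonempty S] {P : Matrix S S ℝ} (hirr : P.IsIrreducible)
    (hap : IsAperiodic P) {κ : S → ℝ} (hκ : IsStationary P κ) (u : S) : 0 < κ u := by
  obtain ⟨N, hN⟩ := exists_pow_pos hirr hap
  obtain ⟨s, hs⟩ : ∃ s, 0 < κ s := by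
    by_contra! h
    have := hκ.sum_eq_one
    rw [Finset.sum_eq_zero fun s _ => le_antisymm (h s) (hκ.nonneg s)] at this
    norm_num at this
  rw [← hκ.pow N u]
  exact (mul_pos hs (hN s u)).trans_le (Finset.single_le_sum
    (f := fun l => κ l * (P ^ N) l u)
    (fun l _ => mul_nonneg (hκ.nonneg l) (hN l u).le) (Finset.mem_univ s))

/-- The infimum of the empty set of naturals is `0`, so the convergence theorem is needed to know
that the defining set is nonempty. -/
theorem tvDist_mixingTime_le [Nonempty S] {P : Matrix S S ℝ} (hP : IsStochastic P)
    (hirr : P.IsIrreducible) (hap : IsAperiodic P) {κ : S → ℝ} (hκ : IsStationary P κ) {δ : ℝ}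
    (hδ : 0 < δ) (s : S) : tvDist ((P ^ mixingTime P κ δ) s) κ ≤ δ := by
  obtain ⟨κ', hκ'⟩ := exists_tendsto_pow hP hirr hap
  obtain rfl := hκ.eq_of_tendsto hκ'
  have hne : {k : ℕ | ∀ s, tvDist ((P ^ k) s) κ ≤ δ}.Nonempty := by
    have h1 : ∀ s, Filter.Tendsto (fun k => tvDist ((P ^ k) s) κ) Filter.atTop (nhds 0) := by
      intro s
      have := (tendsto_finsetSum Finset.univ fun u _ =>
        ((hκ' s u).sub_const (κ u)).abs).div_const 2
      simpa [tvDist] using this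
    have h2 : ∀ᶠ k in Filter.atTop, ∀ s, tvDist ((P ^ k) s) κ ≤ δ :=
      Filter.eventually_all.2 fun s => (h1 s).eventually_le_const hδ
    exact h2.exists
  exact Nat.sInf_mem hne s

/-- After `T * j` steps the chain is `2⁻ʲ`-close to its stationary distribution. -/
theorem IsStationary.abs_pow_sub_le_of_mixingTime_le [Nonempty S] {P : Matrix S S ℝ}
    (hP : IsStochastic P) (hirr : P.IsIrreducible) (hap : IsAperiodic P) {κ : S → ℝ}
    (hκ : IsStationary P κ) {T : ℕ} (hT : mixingTime P κ (1 / 4) ≤ T) {n j : ℕ}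
    (hn : T * j ≤ n) (s u : S) : |(P ^ n) s u - κ u| ≤ (1 / 2) ^ j := by
  refine hκ.abs_pow_sub_le hP (t := mixingTime P κ (1 / 4)) (fun s s' => ?_)
    ((Nat.mul_le_mul_right _ hT).trans hn) s u
  -- Two rows within `1 / 4` of `κ` are within `1 / 2` of each other, which is the contraction
  -- factor.
  have h := tvDist_mixingTime_le hP hirr hap hκ (δ := 1 / 4) (by norm_num)
  have := tvDist_triangle_right ((P ^ mixingTime P κ (1 / 4)) s)
    ((P ^ mixingTime P κ (1 / 4)) s') κ
  linarith [h s, h s']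

end Chain

/-! ### Expectations along the trajectory law -/

section TrajectoryLaw

theorem MDP.summable_discounted {S A : Type*} [Fintype S] (M : MDP S A) (z : ℕ → S × A) : Summable fun k => M.γ ^ k * M.R (z k) := by
  refine Summable.of_nonneg_of_le (fun k => mul_nonneg (pow_nonneg M.γ_pos.le _) (M.R_nonneg _))
    (fun k => ?_) (summable_geometric_of_lt_one M.γ_pos.le M.γ_lt_one)
  exact mul_le_of_le_one_right (pow_nonneg M.γ_pos.le _) (M.R_le_one _)

variable {S A : Type*} [Fintype S] [Fintype A]

/-- Transition probabilities of the chain `(S_k, A_k)`. -/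
def MDP.trans (M : MDP S A) (π : Policy S A) (x y : S × A) : ℝ :=
  M.P x.2 x.1 y.1 * π y.1 y.2

theorem MDP.trans_nonneg (M : MDP S A) (π : Policy S A) (x y : S × A) : 0 ≤ M.trans π x y :=
  mul_nonneg (M.P_nonneg _ _ _) (π.nonneg _ _)

theorem MDP.sum_trans_mul (M : MDP S A) (π : Policy S A) (x : S × A) (f : S × A → ℝ) :
    ∑ y, M.trans π x y * f y = ∑ s', M.P x.2 x.1 s' * ∑ a', π s' a' * f (s', a') := by
  simp_rw [Fintype.sum_prod_type, MDP.trans, Finset.mul_sum, mul_assoc]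

theorem MDP.sum_trans (M : MDP S A) (π : Policy S A) (x : S × A) : ∑ y, M.trans π x y = 1 := by
  simpa [π.sum_eq_one, M.P_sum] using M.sum_trans_mul π x fun _ => 1

variable [MeasurableSpace S] [MeasurableSpace A]
  [DiscreteMeasurableSpace S] [DiscreteMeasurableSpace A]

theorem MDP.integral_stepMeasure (M : MDP S A) (π : Policy S A) (x : S × A) (f : S × A → ℝ) :
    ∫ y, f y ∂(M.stepMeasure π x) = ∑ y, M.trans π x y * f y := by
  rw [MDP.stepMeasure, integral_finsetSum_measure]
  · refine Finset.sum_congr rfl fun y _ => ?_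
    rw [integral_smul_measure, integral_dirac, 
      ENNReal.toReal_ofReal (mul_nonneg (M.P_nonneg _ _ _) (π.nonneg _ _))]
    rfl
  · intro y _
    exact Integrable.smul_measure (integrable_dirac (by simp)) ENNReal.ofReal_ne_top

theorem integrable_comp_of_finite {Ω X : Type*} [MeasurableSpace Ω] [Finite X]
    [MeasurableSpace X] [DiscreteMeasurableSpace X] {μ : Measure Ω} [IsFiniteMeasure μ]
    {Y : Ω → X} (hY : Measurable Y) (f : X → ℝ) : Integrable (fun ω => f (Y ω)) μ :=
  (Integrable.of_finite (μ := μ.map Y) (f := f)).comp_measurable hY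

variable (M : MDP S A) (π : Policy S A) (μ₀ : Measure (S × A)) [IsProbabilityMeasure μ₀]

instance : IsProbabilityMeasure (M.trajectoryLaw π μ₀) := by
  unfold MDP.trajectoryLaw; infer_instance

omit [IsProbabilityMeasure μ₀] in
theorem MDP.map_zero_trajectoryLaw : (M.trajectoryLaw π μ₀).map (fun z => z 0) = μ₀ := by
  have h : (fun z : ℕ → S × A => z 0) =
      (MeasurableEquiv.piUnique (fun _ : Finset.Iic 0 => S × A)) ∘
        (Preorder.frestrictLe (π := fun _ : ℕ => S × A) 0) := rfl
  rw [h, ← Measure.map_map (by fun_prop) (by fun_prop), MDP.trajectoryLaw, Kernel.trajMeasure,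
    Measure.map_comp _ _ (by fun_prop), Kernel.traj_map_frestrictLe, Kernel.partialTraj_self,
    Measure.id_comp, Measure.map_map (by fun_prop) (by fun_prop)]
  rw [MeasurableEquiv.self_comp_symm, Measure.map_id]

omit [IsProbabilityMeasure μ₀] in
theorem MDP.integral_zero_trajectoryLaw (f : S × A → ℝ) :
    ∫ z, f (z 0) ∂(M.trajectoryLaw π μ₀) = ∫ x, f x ∂μ₀ := by
  conv_rhs => rw [← M.map_zero_trajectoryLaw π μ₀]
  rw [integral_map (measurable_pi_apply 0).aemeasurable (by fun_prop)]

theorem MDP.integral_succ_trajectoryLaw (f : S × A → ℝ) (n : ℕ) :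
    ∫ z, f (z (n + 1)) ∂(M.trajectoryLaw π μ₀) =
      ∫ z, ∑ y, M.trans π (z n) y * f y ∂(M.trajectoryLaw π μ₀) := by
  have h := Kernel.map_frestrictLe_trajMeasure_compProd_eq_map_trajMeasure
    (X := fun _ => S × A) (μ₀ := μ₀) (κ := fun n => M.historyKernel π n) (a := n)
  have h1 : ∫ z, f (z (n + 1)) ∂(M.trajectoryLaw π μ₀) =
      ∫ p, f p.2 ∂((M.trajectoryLaw π μ₀).map
        (fun x => (Preorder.frestrictLe (π := fun _ : ℕ => S × A) n x, x (n + 1)))) := by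
    rw [integral_map (by fun_prop) (by fun_prop)]
  rw [h1]
  unfold MDP.trajectoryLaw
  rw [← h, Measure.integral_compProd (integrable_comp_of_finite measurable_snd f),
    integral_map (by fun_prop) (by fun_prop)]
  refine integral_congr_ae (Filter.Eventually.of_forall fun z => ?_)
  exact M.integral_stepMeasure π (z n) f

/-- The expected return is the expectation at time zero of any solution of the Bellman equation
of the policy. -/
theorem MDP.integral_discountedReturn {q : S × A → ℝ}
    (hq : ∀ x, q x = M.R x + M.γ * ∑ y, M.trans π x y * q y) :
    ∫ z, M.discountedReturn z ∂(M.trajectoryLaw π μ₀) = ∫ x, q x ∂μ₀ := by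
  set ν := M.trajectoryLaw π μ₀
  have hint : ∀ (f : S × A → ℝ) k, Integrable (fun z : ℕ → S × A => f (z k)) ν := fun f k =>
    integrable_comp_of_finite (Y := fun z : ℕ → S × A => z k) (measurable_pi_apply k) f
  -- The Bellman equation and the Markov property write the expected reward as a difference, so the
  -- discounted sum telescopes.
  have hstep : ∀ k, ∫ z, M.R (z k) ∂ν = ∫ z, q (z k) ∂ν - M.γ * ∫ z, q (z (k + 1)) ∂ν := by
    intro k
    rw [M.integral_succ_trajectoryLaw π μ₀ q k, ← integral_const_mul, ← integral_sub (hint _ _)]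
    · refine integral_congr_ae (Filter.Eventually.of_forall fun z => ?_)
      simp only
      linarith [hq (z k)]
    · exact hint (fun x => M.γ * ∑ y, M.trans π x y * q y) k
  have hsum : ∀ n, ∑ k ∈ Finset.range n, M.γ ^ k * ∫ z, M.R (z k) ∂ν =
      ∫ x, q x ∂μ₀ - M.γ ^ n * ∫ z, q (z n) ∂ν := by
    intro n
    induction n with
    | zero => simp [ν, M.integral_zero_trajectoryLaw π μ₀ q]
    | succ n ih => rw [Finset.sum_range_succ, ih, hstep]; ring
  have hlim : Filter.Tendsto (fun n => ∫ x, q x ∂μ₀ - M.γ ^ n * ∫ z, q (z n) ∂ν) Filter.atTop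
      (nhds (∫ x, q x ∂μ₀)) := by
    have h0 : Filter.Tendsto (fun n => M.γ ^ n * ∫ z, q (z n) ∂ν) Filter.atTop (nhds 0) := by
      have hb : Filter.Tendsto (fun n => M.γ ^ n * ‖q‖) Filter.atTop (nhds 0) := by
        simpa using (tendsto_pow_atTop_nhds_zero_of_lt_one M.γ_pos.le M.γ_lt_one).mul_const ‖q‖
      refine squeeze_zero_norm (fun n => ?_) hb
      rw [norm_mul, Real.norm_of_nonneg (pow_nonneg M.γ_pos.le n)]
      refine mul_le_mul_of_nonneg_left ?_ (pow_nonneg M.γ_pos.le n)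
      have := norm_integral_le_of_norm_le_const (μ := ν) (f := fun z => q (z n)) (C := ‖q‖)
        (Filter.Eventually.of_forall fun z => norm_le_pi_norm q (z n))
      simpa using this
    simpa using h0.const_sub (∫ x, q x ∂μ₀)
  have hdom : Filter.Tendsto (fun n => ∫ z, ∑ k ∈ Finset.range n, M.γ ^ k * M.R (z k) ∂ν)
      Filter.atTop (nhds (∫ z, M.discountedReturn z ∂ν)) := by
    refine tendsto_integral_of_dominated_convergence (fun _ => ∑' k, M.γ ^ k) (fun n => ?_)
      (integrable_const _) (fun n => ?_) (Filter.Eventually.of_forall fun z => ?_)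
    · exact (integrable_finsetSum _ fun k _ => (hint M.R k).const_mul _).aestronglyMeasurable
    · refine Filter.Eventually.of_forall fun z => ?_
      rw [Real.norm_of_nonneg (Finset.sum_nonneg fun k _ =>
        mul_nonneg (pow_nonneg M.γ_pos.le _) (M.R_nonneg _))]
      refine le_trans (Finset.sum_le_sum fun k _ => ?_)
        ((summable_geometric_of_lt_one M.γ_pos.le M.γ_lt_one).sum_le_tsum (Finset.range n)
          fun k _ => pow_nonneg M.γ_pos.le _)
      exact mul_le_of_le_one_right (pow_nonneg M.γ_pos.le _) (M.R_le_one _)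
    · exact (M.summable_discounted z).hasSum.tendsto_sum_nat
  refine tendsto_nhds_unique hdom (hlim.congr fun n => ?_)
  rw [← hsum, integral_finsetSum _ fun k _ => (hint M.R k).const_mul _]
  simp_rw [integral_const_mul]

end TrajectoryLaw

/-! ### The Bellman equations -/

section Bellman

theorem abs_iSup_sub_iSup_le {A : Type*} [Finite A] [Nonempty A] {f g : A → ℝ} {d : ℝ}
    (h : ∀ a, |f a - g a| ≤ d) : |(⨆ a, f a) - ⨆ a, g a| ≤ d := by
  have hf : ∀ a, f a ≤ ⨆ a, f a := fun a => le_ciSup (Set.finite_range f).bddAbove a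
  have hg : ∀ a, g a ≤ ⨆ a, g a := fun a => le_ciSup (Set.finite_range g).bddAbove a
  have h1 : (⨆ a, f a) ≤ (⨆ a, g a) + d := ciSup_le fun a => by
    linarith [(abs_le.1 (h a)).2, hg a]
  have h2 : (⨆ a, g a) ≤ (⨆ a, f a) + d := ciSup_le fun a => by
    linarith [(abs_le.1 (h a)).1, hf a]
  exact abs_le.2 ⟨by linarith, by linarith⟩

theorem abs_sum_mul_le {X : Type*} [Fintype X] {p f : X → ℝ} (hp : ∀ x, 0 ≤ p x)
    (h1 : ∑ x, p x = 1) {d : ℝ} (hf : ∀ x, |f x| ≤ d) : |∑ x, p x * f x| ≤ d := by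
  calc |∑ x, p x * f x| ≤ ∑ x, |p x * f x| := Finset.abs_sum_le_sum_abs _ _
    _ ≤ ∑ x, p x * d := by
        refine Finset.sum_le_sum fun x _ => ?_
        rw [abs_mul, abs_of_nonneg (hp x)]
        exact mul_le_mul_of_nonneg_left (hf x) (hp x)
    _ = d := by rw [← Finset.sum_mul, h1, one_mul]

theorem exists_fixedPoint_of_contraction {X : Type*} [Fintype X] {c : ℝ} (hc0 : 0 ≤ c)
    (hc1 : c < 1) (F : (X → ℝ) → X → ℝ)
    (hF : ∀ f g x, |F f x - F g x| ≤ c * ‖f - g‖) : ∃ f, ∀ x, f x = F f x := by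
  have hcon : ContractingWith ⟨c, hc0⟩ F := by
    refine ⟨by exact_mod_cast hc1, LipschitzWith.of_dist_le_mul fun f g => ?_⟩
    rw [dist_eq_norm, dist_eq_norm]
    exact (pi_norm_le_iff_of_nonneg (mul_nonneg hc0 (norm_nonneg _))).2 fun x => hF f g x
  exact ⟨_, fun x => (congrFun hcon.fixedPoint_isFixedPt x).symm⟩

variable {S A : Type*} [Fintype S] [Fintype A]

theorem MDP.exists_bellman_policy (M : MDP S A) (π : Policy S A) :
    ∃ q : S × A → ℝ, ∀ x, q x = M.R x + M.γ * ∑ y, M.trans π x y * q y := by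
  refine exists_fixedPoint_of_contraction M.γ_pos.le M.γ_lt_one
    (fun q x => M.R x + M.γ * ∑ y, M.trans π x y * q y) fun f g x => ?_
  rw [add_sub_add_left_eq_sub, ← mul_sub, abs_mul, abs_of_pos M.γ_pos,
    ← Finset.sum_sub_distrib]
  simp_rw [← mul_sub]
  exact mul_le_mul_of_nonneg_left (abs_sum_mul_le (M.trans_nonneg π x) (M.sum_trans π x)
    fun y => norm_le_pi_norm (f - g) y) M.γ_pos.le

/-- The Bellman optimality equation. -/
def MDP.IsBellmanOptimal (M : MDP S A) (Q : S × A → ℝ) : Prop :=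
  ∀ x, Q x = M.R x + M.γ * ∑ s', M.P x.2 x.1 s' * ⨆ a', Q (s', a')

theorem MDP.exists_isBellmanOptimal [Nonempty A] (M : MDP S A) :
    ∃ Q : S × A → ℝ, M.IsBellmanOptimal Q := by
  refine exists_fixedPoint_of_contraction M.γ_pos.le M.γ_lt_one
    (fun Q x => M.R x + M.γ * ∑ s', M.P x.2 x.1 s' * ⨆ a', Q (s', a')) fun f g x => ?_
  rw [add_sub_add_left_eq_sub, ← mul_sub, abs_mul, abs_of_pos M.γ_pos,
    ← Finset.sum_sub_distrib]
  simp_rw [← mul_sub]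
  exact mul_le_mul_of_nonneg_left (abs_sum_mul_le (M.P_nonneg x.2 x.1) (M.P_sum x.2 x.1)
    fun s => abs_iSup_sub_iSup_le fun a => norm_le_pi_norm (f - g) (s, a)) M.γ_pos.le

theorem sum_mul_le_of_le {X : Type*} [Fintype X] {p f : X → ℝ} (hp : ∀ x, 0 ≤ p x)
    (h1 : ∑ x, p x = 1) {d : ℝ} (hf : ∀ x, f x ≤ d) : ∑ x, p x * f x ≤ d := by
  calc ∑ x, p x * f x ≤ ∑ x, p x * d :=
        Finset.sum_le_sum fun x _ => mul_le_mul_of_nonneg_left (hf x) (hp x)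
    _ = d := by rw [← Finset.sum_mul, h1, one_mul]

/-- Maximum principle: at a pair maximizing `q - Q` the gap `d` satisfies `d ≤ γ d`, hence `d ≤ 0`.
-/
theorem MDP.bellman_policy_le [Nonempty S] [Nonempty A] (M : MDP S A) (π : Policy S A)
    {q Q : S × A → ℝ} (hq : ∀ x, q x = M.R x + M.γ * ∑ y, M.trans π x y * q y)
    (hQ : M.IsBellmanOptimal Q) (x : S × A) : q x ≤ Q x := by
  obtain ⟨m, hm⟩ := Finite.exists_max fun x => q x - Q x
  set d := q m - Q m
  have hV : ∀ s, ∑ a, π s a * q (s, a) ≤ (⨆ a, Q (s, a)) + d := fun s =>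
    sum_mul_le_of_le (π.nonneg s) (π.sum_eq_one s) fun a => by
      have := hm (s, a)
      have := le_ciSup (Set.finite_range fun a => Q (s, a)).bddAbove a
      linarith
  have h1 : d ≤ M.γ * d := by
    have h2 : ∑ s', M.P m.2 m.1 s' * (∑ a, π s' a * q (s', a) - ⨆ a, Q (s', a)) ≤ d :=
      sum_mul_le_of_le (M.P_nonneg _ _) (M.P_sum _ _) fun s => by linarith [hV s]
    simp_rw [mul_sub, Finset.sum_sub_distrib] at h2
    have h3 := mul_le_mul_of_nonneg_left h2 M.γ_pos.le
    have h4 := hq m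
    rw [M.sum_trans_mul] at h4
    have h5 := hQ m
    simp only [d] at *
    linarith
  have hd : d ≤ 0 := by nlinarith [M.γ_lt_one]
  have := hm x
  linarith

theorem MDP.IsBellmanOptimal.nonneg_and_le [Nonempty S] [Nonempty A] {M : MDP S A}
    {Q : S × A → ℝ} (hQ : M.IsBellmanOptimal Q) (x : S × A) :
    0 ≤ Q x ∧ Q x ≤ 1 / (1 - M.γ) := by
  have hγ : 0 < 1 - M.γ := by linarith [M.γ_lt_one]
  constructor
  · obtain ⟨m, hm⟩ := Finite.exists_min Q
    have h1 : ∑ s', M.P m.2 m.1 s' * -(⨆ a, Q (s', a)) ≤ - Q m :=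
      sum_mul_le_of_le (M.P_nonneg _ _) (M.P_sum _ _) fun s => by
        obtain ⟨a⟩ := ‹Nonempty A›
        have := le_ciSup (Set.finite_range fun a => Q (s, a)).bddAbove a
        linarith [hm (s, a)]
    simp_rw [mul_neg, Finset.sum_neg_distrib] at h1
    have h2 := hQ m
    have h3 := M.R_nonneg m
    have := mul_le_mul_of_nonneg_left h1 M.γ_pos.le
    have : 0 ≤ Q m := by nlinarith
    linarith [hm x]
  · obtain ⟨m, hm⟩ := Finite.exists_max Q
    have h1 : ∑ s', M.P m.2 m.1 s' * (⨆ a, Q (s', a)) ≤ Q m :=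
      sum_mul_le_of_le (M.P_nonneg _ _) (M.P_sum _ _) fun s => ciSup_le fun a => hm (s, a)
    have h2 := hQ m
    have h3 := M.R_le_one m
    have := mul_le_mul_of_nonneg_left h1 M.γ_pos.le
    refine (hm x).trans ?_
    rw [le_div_iff₀ hγ]
    nlinarith

/-- The deterministic policy choosing the action `g s` in the state `s`. -/
def Policy.deterministic [DecidableEq A] (g : S → A) : Policy S A where
  prob s a := if a = g s then 1 else 0
  nonneg s a := by split_ifs <;> norm_num
  sum_eq_one s := by simp

variable [MeasurableSpace S] [MeasurableSpace A]
  [DiscreteMeasurableSpace S] [DiscreteMeasurableSpace A]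

theorem MDP.Qfun_eq (M : MDP S A) (π : Policy S A) {q : S × A → ℝ}
    (hq : ∀ x, q x = M.R x + M.γ * ∑ y, M.trans π x y * q y) : M.Qfun π = q := by
  ext x
  rw [MDP.Qfun, M.integral_discountedReturn π _ hq, integral_dirac]

theorem MDP.Vfun_eq (M : MDP S A) (π : Policy S A) {q : S × A → ℝ}
    (hq : ∀ x, q x = M.R x + M.γ * ∑ y, M.trans π x y * q y) (s : S) :
    M.Vfun π s = ∑ a, π s a * q (s, a) := by
  have : IsProbabilityMeasure
      (∑ a, ENNReal.ofReal (π s a) • Measure.dirac (s, a) : Measure (S × A)) := by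
    constructor
    simp only [Measure.coe_finsetSum, Finset.sum_apply, Measure.smul_apply, measure_univ,
      smul_eq_mul, mul_one]
    rw [← ENNReal.ofReal_sum_of_nonneg fun a _ => π.nonneg s a, π.sum_eq_one, ENNReal.ofReal_one]
  rw [MDP.Vfun, M.integral_discountedReturn π _ hq, integral_finsetSum_measure]
  · refine Finset.sum_congr rfl fun a _ => ?_
    rw [integral_smul_measure, integral_dirac, ENNReal.toReal_ofReal (π.nonneg s a), smul_eq_mul]
  · intro a _
    exact Integrable.smul_measure (integrable_dirac (by simp)) ENNReal.ofReal_ne_top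

/-- The optimal `Q`-functions are the solutions of the Bellman optimality equation. -/
theorem MDP.isOptimalQ_iff [Nonempty S] [Nonempty A] (M : MDP S A)
    {Q : S × A → ℝ} (hQ : M.IsBellmanOptimal Q) (Qs : S × A → ℝ) :
    M.IsOptimalQ Qs ↔ Qs = Q := by
  classical
  have hg : ∀ s, ∃ a, ∀ a', Q (s, a') ≤ Q (s, a) := fun s =>
    Finite.exists_max fun a => Q (s, a)
  choose g hg using hg
  have hgs : ∀ s, ⨆ a, Q (s, a) = Q (s, g s) := fun s =>
    le_antisymm (ciSup_le (hg s))
      (le_ciSup (f := fun a => Q (s, a)) (Set.finite_range fun a => Q (s, a)).bddAbove (g s))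
  set πg : Policy S A := Policy.deterministic g
  have hsum : ∀ (f : S × A → ℝ) s, ∑ a, πg s a * f (s, a) = f (s, g s) := fun f s => by
    simp [πg, Policy.deterministic]
  have hQg : ∀ x, Q x = M.R x + M.γ * ∑ y, M.trans πg x y * Q y := fun x => by
    rw [M.sum_trans_mul]
    simp_rw [hsum, ← hgs]
    exact hQ x
  have hVg : ∀ s, M.Vfun πg s = Q (s, g s) := fun s => by rw [M.Vfun_eq πg hQg, hsum]
  have hle : ∀ (π : Policy S A) s, M.Vfun π s ≤ Q (s, g s) := fun π s => by
    obtain ⟨q, hq⟩ := M.exists_bellman_policy π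
    rw [M.Vfun_eq π hq]
    exact sum_mul_le_of_le (π.nonneg s) (π.sum_eq_one s) fun a =>
      (M.bellman_policy_le π hq hQ _).trans (hg s a)
  have hopt : M.IsOptimal πg := fun π' s => by rw [hVg]; exact hle π' s
  constructor
  · rintro ⟨π, hπ, rfl⟩
    obtain ⟨q, hq⟩ := M.exists_bellman_policy π
    rw [M.Qfun_eq π hq]
    ext x
    -- Optimality against the greedy policy forces the value of `π` to be `max_a Q`; substituted in
    -- the Bellman equation of `π`, this gives `q = Q`.
    have hV : ∀ s, ∑ a, π s a * q (s, a) = ⨆ a, Q (s, a) := fun s => by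
      rw [← M.Vfun_eq π hq, hgs]
      exact le_antisymm (hle π s) ((hVg s).symm.le.trans (hπ πg s))
    rw [hq, M.sum_trans_mul, hQ x]
    simp_rw [hV]
  · rintro rfl
    exact ⟨πg, hopt, M.Qfun_eq πg hQg⟩

end Bellman

/-! ### Functionals of a sample trajectory -/

section Paths

/-- `G` only depends on the path up to time `i`. -/
def DependsOnPast {X Y : Type*} (i : ℕ) (G : (ℕ → X) → Y) : Prop :=
  ∀ z z', (∀ j ≤ i, z j = z' j) → G z = G z'

/-- The path that follows `h` and then stays at its last point. -/
def extendPath {X : Type*} {i : ℕ} (h : Fin (i + 1) → X) : ℕ → X :=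
  fun j => h ⟨min j i, by omega⟩

theorem DependsOnPast.eq_extendPath {X Y : Type*} {i : ℕ} {G : (ℕ → X) → Y}
    (hG : DependsOnPast i G) (z : ℕ → X) :
    G z = G (extendPath (i := i) fun j => z j) :=
  hG _ _ fun j hj => by simp [extendPath, hj]

theorem IsTrajectory.measurable_restrict {S A Ω : Type*} [Fintype S] [Fintype A]
    [MeasurableSpace S] [MeasurableSpace A] [MeasurableSpace Ω] {M : MDP S A} {π : Policy S A}
    {μ : Measure Ω} {Z : ℕ → Ω → S × A} (hZ : IsTrajectory M π μ Z) (i : ℕ) :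
    Measurable fun ω => fun j : Fin (i + 1) => Z j ω :=
  measurable_pi_lambda _ fun j => hZ.measurable j

variable {S A Ω : Type*} [Fintype S] [Fintype A] [MeasurableSpace S] [MeasurableSpace A]
  [DiscreteMeasurableSpace S] [DiscreteMeasurableSpace A] [MeasurableSpace Ω]
  {M : MDP S A} {π : Policy S A} {μ : Measure Ω} [IsProbabilityMeasure μ] {Z : ℕ → Ω → S × A}

theorem IsTrajectory.integrable (hZ : IsTrajectory M π μ Z) {i : ℕ} {G : (ℕ → S × A) → ℝ}
    (hG : DependsOnPast i G) : Integrable (fun ω => G fun k => Z k ω) μ := by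
  simp_rw [fun ω => hG.eq_extendPath fun k => Z k ω]
  exact integrable_comp_of_finite (hZ.measurable_restrict i) fun h => G (extendPath h)

theorem IsTrajectory.integral_eq_sum (hZ : IsTrajectory M π μ Z) {i : ℕ}
    {G : (ℕ → S × A) → ℝ} (hG : DependsOnPast i G) :
    ∫ ω, G (fun k => Z k ω) ∂μ =
      ∑ h : Fin (i + 1) → S × A, μ.real {ω | ∀ j ≤ i, Z j ω = extendPath h j} *
        G (extendPath h) := by
  simp_rw [fun ω => hG.eq_extendPath fun k => Z k ω]
  rw [← integral_map (f := fun h : Fin (i + 1) → S × A => G (extendPath h))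
    (hZ.measurable_restrict i).aemeasurable (by fun_prop), integral_fintype Integrable.of_finite]
  refine Finset.sum_congr rfl fun h _ => ?_
  rw [map_measureReal_apply (hZ.measurable_restrict i) (measurableSet_singleton _), smul_eq_mul]
  congr 2
  ext ω
  simp only [Set.mem_preimage, Set.mem_singleton_iff, Set.mem_ofPred_eq, funext_iff]
  constructor
  · intro hω j hj
    have := hω ⟨j, by omega⟩
    simpa [extendPath, hj] using this
  · intro hω j
    have := hω j (by omega)
    simpa [extendPath, show min (j : ℕ) i = j by omega] using this

/-- The Markov property. -/
theorem IsTrajectory.integral_succ (hZ : IsTrajectory M π μ Z) {i : ℕ}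
    {Φ : (ℕ → S × A) → S × A → ℝ} (hΦ : DependsOnPast i Φ) :
    ∫ ω, Φ (fun k => Z k ω) (Z (i + 1) ω) ∂μ =
      ∫ ω, ∑ y, M.trans π (Z i ω) y * Φ (fun k => Z k ω) y ∂μ := by
  have hL : DependsOnPast (i + 1) fun z : ℕ → S × A => Φ z (z (i + 1)) := fun z z' hz => by
    simp only
    rw [hΦ z z' fun j hj => hz j (by omega), hz (i + 1) le_rfl]
  have hR : DependsOnPast i fun z : ℕ → S × A => ∑ y, M.trans π (z i) y * Φ z y :=
    fun z z' hz => by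
      simp only
      rw [hΦ z z' hz, hz i le_rfl]
  -- A history up to time `i + 1` is split into its last pair and the history up to time `i`; the
  -- two product formulas then differ by one transition factor.
  rw [hZ.integral_eq_sum hR, hZ.integral_eq_sum hL,
    ← (Fin.snocEquiv fun _ => S × A).sum_comp, Fintype.sum_prod_type, Finset.sum_comm]
  refine Finset.sum_congr rfl fun h _ => ?_
  rw [Finset.mul_sum]
  refine Finset.sum_congr rfl fun y _ => ?_
  set z := extendPath (i := i + 1) (Fin.snocEquiv (fun _ => S × A) (y, h)) with hz
  have hz1 : ∀ j ≤ i, z j = extendPath h j := fun j hj => by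
    simp only [hz, extendPath, Fin.snocEquiv_apply]
    have : (⟨min j (i + 1), by omega⟩ : Fin (i + 2)) = Fin.castSucc ⟨min j i, by omega⟩ := by
      ext; simp; omega
    rw [this, Fin.snoc_castSucc]
  have hz2 : z (i + 1) = y := by
    simp only [hz, extendPath, Fin.snocEquiv_apply]
    have : (⟨min (i + 1) (i + 1), by omega⟩ : Fin (i + 2)) = Fin.last (i + 1) := by
      ext; simp
    rw [this, Fin.snoc_last]
  rw [hΦ z _ hz1, hz2, hZ.law (i + 1) z, Finset.prod_range_succ, ← mul_assoc, ← hZ.law i z, hz2,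
    hz1 i le_rfl]
  have hset : {ω | ∀ j ≤ i, Z j ω = z j} = {ω | ∀ j ≤ i, Z j ω = extendPath h j} := by
    ext ω
    exact forall₂_congr fun j hj => by rw [hz1 j hj]
  rw [hset, MDP.trans]
  ring

theorem IsTrajectory.integral_mul_add (hZ : IsTrajectory M π μ Z) {i : ℕ}
    {G : (ℕ → S × A) → ℝ} (hG : DependsOnPast i G) (f : S × A → ℝ) (r : ℕ) :
    ∫ ω, G (fun k => Z k ω) * f (Z (i + r) ω) ∂μ =
      ∫ ω, G (fun k => Z k ω) *
        ((fun f x => ∑ y, M.trans π x y * f y)^[r] f) (Z i ω) ∂μ := by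
  induction r generalizing f with
  | zero => rfl
  | succ r ih =>
    rw [Function.iterate_succ_apply, ← ih]
    have hΦ : DependsOnPast (i + r) fun (z : ℕ → S × A) y => G z * f y := fun z z' hz => by
      ext y
      simp only [hG z z' fun j hj => hz j (by omega)]
    rw [← add_assoc, hZ.integral_succ hΦ]
    congr 1
    ext ω
    rw [Finset.mul_sum]
    exact Finset.sum_congr rfl fun y _ => by ring

end Paths

/-! ### Visits of the state-action pairs -/

section Visits

variable {S A : Type*} [Fintype S] [Fintype A]

theorem MDP.isStochastic_stateChain (M : MDP S A) (π : Policy S A) :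
    IsStochastic (M.stateChain π) := by
  refine ⟨fun s s' => Finset.sum_nonneg fun a _ => mul_nonneg (π.nonneg _ _) (M.P_nonneg _ _ _),
    fun s => ?_⟩
  simp only [MDP.stateChain, Matrix.of_apply]
  rw [Finset.sum_comm]
  simp_rw [← Finset.mul_sum, M.P_sum, mul_one, π.sum_eq_one]

theorem MDP.stateChain_mulVec (M : MDP S A) (π : Policy S A) (g : S → ℝ) (s : S) :
    (M.stateChain π).mulVec g s = ∑ a, π s a * ∑ s', M.P a s s' * g s' := by
  have h : (M.stateChain π).mulVec g s = ∑ s', (∑ a, π s a * M.P a s s') * g s' := rfl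
  rw [h]
  simp_rw [Finset.sum_mul, Finset.mul_sum, mul_assoc]
  rw [Finset.sum_comm]

theorem minVisit_le (κ : S → ℝ) (π : S → A → ℝ) (x : S × A) :
    minVisit κ π ≤ κ x.1 * π x.1 x.2 :=
  ciInf_le (Set.finite_range fun x : S × A => κ x.1 * π x.1 x.2).bddBelow x

theorem Policy.le_one {S A : Type*} [Fintype A] (π : Policy S A) (s : S) (a : A) : π s a ≤ 1 := by
  rw [← π.sum_eq_one s]
  exact Finset.single_le_sum (f := π s) (fun a _ => π.nonneg s a) (Finset.mem_univ a)

variable [DecidableEq S]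

theorem MDP.sum_policy_mul_iterate (M : MDP S A) (π : Policy S A) (f : S × A → ℝ) (r : ℕ)
    (s : S) :
    ∑ a, π s a * ((fun f x => ∑ y, M.trans π x y * f y)^[r] f) (s, a) =
      ((M.stateChain π) ^ r).mulVec (fun s => ∑ a, π s a * f (s, a)) s := by
  induction r generalizing s with
  | zero => simp
  | succ r ih =>
    rw [pow_succ', ← Matrix.mulVec_mulVec, M.stateChain_mulVec]
    refine Finset.sum_congr rfl fun a _ => ?_
    rw [Function.iterate_succ_apply', M.sum_trans_mul]
    exact congrArg _ (Finset.sum_congr rfl fun s' _ => congrArg _ (ih s'))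

variable [DecidableEq A]

/-- The first step leaves `y` under its own action; only from then on do the states follow
`stateChain`. Hence `r + 1` steps against the power `r`. -/
theorem MDP.iterate_indicator (M : MDP S A) (π : Policy S A) (x y : S × A) (r : ℕ) :
    ((fun f x => ∑ y, M.trans π x y * f y)^[r + 1] (Pi.single x 1)) y =
      ∑ s', M.P y.2 y.1 s' * (((M.stateChain π) ^ r) s' x.1 * π x.1 x.2) := by
  rw [Function.iterate_succ_apply', M.sum_trans_mul]
  simp_rw [M.sum_policy_mul_iterate]
  refine Finset.sum_congr rfl fun s' _ => ?_
  congr 1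
  have : (fun s => ∑ a, π s a * (Pi.single x (1 : ℝ) : S × A → ℝ) (s, a)) =
      π x.1 x.2 • Pi.single x.1 1 := by
    ext s
    simp only [Pi.single_apply, Prod.ext_iff, Pi.smul_apply, smul_eq_mul, mul_ite, mul_one,
      mul_zero]
    by_cases hs : s = x.1
    · subst hs; simp
    · simp [hs]
  rw [this, Matrix.mulVec_smul, pow_mulVec_single, Pi.smul_apply, smul_eq_mul, mul_comm]

/-- From every pair, every other pair is reached with probability at least `N_min / 2` at a
time that exceeds the mixing time by a logarithmic factor. -/
theorem MDP.minVisit_le_iterate_indicator [Nonempty S] {M : MDP S A} {π : Policy S A}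
    (hirr : (M.stateChain π).IsIrreducible) (hap : IsAperiodic (M.stateChain π)) {κ : S → ℝ}
    (hκ : IsStationary (M.stateChain π) κ) {T : ℕ}
    (hT : mixingTime (M.stateChain π) κ (1 / 4) ≤ T) {j : ℕ}
    (hj : (1 / 2 : ℝ) ^ j ≤ minVisit κ π / 2) (x y : S × A) :
    minVisit κ π / 2 ≤
      ((fun f x => ∑ y, M.trans π x y * f y)^[T * j + 1] (Pi.single x 1)) y := by
  rw [M.iterate_indicator]
  have h0 := π.nonneg x.1 x.2
  have h1 := minVisit_le κ π x
  have h2 : minVisit κ π ≤ κ x.1 :=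
    h1.trans (mul_le_of_le_one_right (hκ.nonneg _) (π.le_one _ _))
  have h3 : ∀ s', minVisit κ π / 2 ≤
      ((M.stateChain π) ^ (T * j)) s' x.1 * π x.1 x.2 := fun s' => by
    have h4 := (abs_le.1 (hκ.abs_pow_sub_le_of_mixingTime_le (M.isStochastic_stateChain π)
      hirr hap hT le_rfl s' x.1 (j := j))).1
    -- The deviation is at most `2⁻ʲ ≤ N_min / 2 ≤ κ / 2`.
    have h5 : κ x.1 / 2 ≤ ((M.stateChain π) ^ (T * j)) s' x.1 := by linarith
    have := mul_le_mul_of_nonneg_right h5 h0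
    linarith
  calc minVisit κ π / 2 = ∑ s', M.P y.2 y.1 s' * (minVisit κ π / 2) := by
        rw [← Finset.sum_mul, M.P_sum, one_mul]
    _ ≤ _ := Finset.sum_le_sum fun s' _ =>
        mul_le_mul_of_nonneg_left (h3 s') (M.P_nonneg _ _ _)

/-- The factor by which updates with stepsize `α` discount the entry `x` during the `n` steps
from time `t` on. -/
def decay {X : Type*} [DecidableEq X] (α : ℝ) (x : X) (t n : ℕ) (z : ℕ → X) : ℝ :=
  ∏ i ∈ Finset.range n, if z (t + i) = x then 1 - α else 1

variable {X : Type*} [DecidableEq X] {α : ℝ}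

theorem decay_nonneg (hα1 : α ≤ 1) (x : X) (t n : ℕ) (z : ℕ → X) : 0 ≤ decay α x t n z :=
  Finset.prod_nonneg fun i _ => by split_ifs <;> linarith

theorem decay_succ (x : X) (t n : ℕ) (z : ℕ → X) :
    decay α x t (n + 1) z = decay α x t n z * if z (t + n) = x then 1 - α else 1 :=
  Finset.prod_range_succ _ _

/-- Of the `r + 1` new factors only the last is kept; it is affine in the indicator of a visit,
whose conditional expectation is controlled. -/
theorem decay_add_le (hα0 : 0 ≤ α) (hα1 : α ≤ 1) (x : X) (t n r : ℕ) (z : ℕ → X) :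
    decay α x t (n + (r + 1)) z ≤
      decay α x t n z * (1 - α * (Pi.single x 1 : X → ℝ) (z (t + n + r))) := by
  rw [← add_assoc, decay_succ]
  have h1 : decay α x t (n + r) z ≤ decay α x t n z := by
    induction r with
    | zero => rfl
    | succ r ih =>
      rw [← add_assoc, decay_succ]
      refine le_trans ?_ ih
      exact mul_le_of_le_one_right (decay_nonneg hα1 _ _ _ _) (by split_ifs <;> linarith)
  have h2 : (if z (t + (n + r)) = x then 1 - α else 1) =
      1 - α * (Pi.single x 1 : X → ℝ) (z (t + n + r)) := by
    rw [Pi.single_apply, ← add_assoc]; split_ifs <;> ring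
  rw [h2]
  refine mul_le_mul_of_nonneg_right h1 ?_
  rw [Pi.single_apply]; split_ifs <;> linarith

theorem dependsOnPast_decay (x : X) (t n : ℕ) : DependsOnPast (t + n) (decay α x t n) :=
  fun z z' hz => Finset.prod_congr rfl fun i hi => by
    rw [hz (t + i) (by have := Finset.mem_range.1 hi; omega)]

variable {Ω : Type*} [MeasurableSpace S] [MeasurableSpace A]
  [DiscreteMeasurableSpace S] [DiscreteMeasurableSpace A] [MeasurableSpace Ω]
  {M : MDP S A} {π : Policy S A} {μ : Measure Ω} [IsProbabilityMeasure μ] {Z : ℕ → Ω → S × A}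

/-- Each block of `r + 1` steps visits `x` at its last step with conditional probability at least
`p`, which contributes a factor `1 - α p`. The weight `G` is there to carry the norm of the
comparison process at the start of a phase. -/
theorem IsTrajectory.integral_decay_mul_le (hZ : IsTrajectory M π μ Z) (hα0 : 0 ≤ α)
    (hα1 : α ≤ 1) {x : S × A} {p : ℝ} {r : ℕ}
    (hp : ∀ y, p ≤ ((fun f x => ∑ y, M.trans π x y * f y)^[r] (Pi.single x 1)) y)
    (hp1 : α * p ≤ 1) {t : ℕ} {G : (ℕ → S × A) → ℝ} (hG : DependsOnPast t G)
    (hG0 : ∀ z, 0 ≤ G z) (m : ℕ) :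
    ∫ ω, decay α x t (m * (r + 1)) (fun k => Z k ω) * G (fun k => Z k ω) ∂μ ≤
      (1 - α * p) ^ m * ∫ ω, G (fun k => Z k ω) ∂μ := by
  induction m with
  | zero => simp [decay]
  | succ m ih =>
    set n := m * (r + 1)
    have hF : DependsOnPast (t + n) fun z => decay α x t n z * G z := fun z z' hz => by
      simp only [dependsOnPast_decay x t n z z' hz, hG z z' fun j hj => hz j (by omega)]
    have hF0 : ∀ z, 0 ≤ decay α x t n z * G z := fun z =>
      mul_nonneg (decay_nonneg hα1 _ _ _ _) (hG0 z)
    have hFs : DependsOnPast (t + n + r) fun z =>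
        decay α x t n z * G z * (Pi.single x 1 : S × A → ℝ) (z (t + n + r)) := fun z z' hz => by
      have := hF z z' fun j hj => hz j (by omega)
      simp only at this ⊢
      rw [this, hz _ le_rfl]
    have hlhs : DependsOnPast (t + (n + (r + 1))) fun z => decay α x t (n + (r + 1)) z * G z :=
      fun z z' hz => by
        simp only [dependsOnPast_decay x t _ z z' hz, hG z z' fun j hj => hz j (by omega)]
    have hlow : p * ∫ ω, decay α x t n (fun k => Z k ω) * G (fun k => Z k ω) ∂μ ≤
        ∫ ω, decay α x t n (fun k => Z k ω) * G (fun k => Z k ω) *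
          (Pi.single x 1 : S × A → ℝ) (Z (t + n + r) ω) ∂μ := by
      rw [hZ.integral_mul_add hF, ← integral_const_mul]
      refine integral_mono ((hZ.integrable hF).const_mul p) ?_ fun ω => ?_
      · refine hZ.integrable (i := t + n) (G := fun z => decay α x t n z * G z *
          ((fun f x => ∑ y, M.trans π x y * f y)^[r] (Pi.single x 1)) (z (t + n)))
          fun z z' hz => ?_
        have := hF z z' hz
        simp only at this ⊢
        rw [this, hz _ le_rfl]
      · simp only
        rw [mul_comm]
        exact mul_le_mul_of_nonneg_left (hp _) (hF0 _)
    have hstep : ∫ ω, decay α x t (n + (r + 1)) (fun k => Z k ω) * G (fun k => Z k ω) ∂μ ≤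
        ∫ ω, (decay α x t n (fun k => Z k ω) * G (fun k => Z k ω) -
          α * (decay α x t n (fun k => Z k ω) * G (fun k => Z k ω) *
            (Pi.single x 1 : S × A → ℝ) (Z (t + n + r) ω))) ∂μ := by
      refine integral_mono (hZ.integrable hlhs)
        ((hZ.integrable hF).sub ((hZ.integrable hFs).const_mul α)) fun ω => ?_
      have := mul_le_mul_of_nonneg_right (decay_add_le hα0 hα1 x t n r fun k => Z k ω)
        (hG0 fun k => Z k ω)
      simp only
      linarith
    rw [integral_sub (hZ.integrable hF) ((hZ.integrable hFs).const_mul α),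
      integral_const_mul] at hstep
    rw [show (m + 1) * (r + 1) = n + (r + 1) by ring, pow_succ', mul_assoc]
    have h1 := mul_le_mul_of_nonneg_left hlow hα0
    have h2 := mul_le_mul_of_nonneg_left ih (by linarith : 0 ≤ 1 - α * p)
    linarith

end Visits

/-! ### Decomposition of the error of asynchronous `Q`-learning -/

section Decomposition

/-- Comparison process for the error: at each step from time `t` on, the entry of the visited
pair is contracted towards `γ` times the norm. -/
def errorBound {X : Type*} [Fintype X] [DecidableEq X] (α γ D : ℝ) (t : ℕ) (z : ℕ → X) :
    ℕ → X → ℝ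
  | 0 => fun _ => D
  | n + 1 => fun x =>
      if x = z (t + n) then
        (1 - α) * errorBound α γ D t z n x + α * (γ * ‖errorBound α γ D t z n‖)
      else errorBound α γ D t z n x

/-! ### The comparison process over a block of steps -/

section ErrorBound

variable {X : Type*} [Fintype X] [DecidableEq X] {α γ D : ℝ}

theorem errorBound_nonneg (hα0 : 0 ≤ α) (hα1 : α ≤ 1) (hγ : 0 ≤ γ) (hD : 0 ≤ D) (t n : ℕ)
    (z : ℕ → X) (x : X) : 0 ≤ errorBound α γ D t z n x := by
  induction n generalizing x with
  | zero => exact hD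
  | succ n ih =>
    simp only [errorBound]
    split_ifs
    · have := mul_nonneg (sub_nonneg.2 hα1) (ih x)
      positivity
    · exact ih x

theorem dependsOnPast_errorBound (t n : ℕ) :
    DependsOnPast (t + n) fun z : ℕ → X => errorBound α γ D t z n := by
  intro z z' hz
  induction n with
  | zero => rfl
  | succ n ih =>
    have h := ih fun j hj => hz j (by omega)
    simp only at h
    funext x
    simp only [errorBound]
    rw [h, hz (t + n) (by omega)]

/-- The first bound keeps the norm from growing and feeds the second, where a visit gives `(1 - α)
(decay + γ) + α γ = (1 - α) decay + γ`. -/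
theorem errorBound_add_le (hα0 : 0 ≤ α) (hα1 : α ≤ 1) (hγ0 : 0 ≤ γ) (hγ1 : γ ≤ 1) (hD : 0 ≤ D)
    (t n h : ℕ) (z : ℕ → X) :
    (∀ x, errorBound α γ D t z (n + h) x ≤ ‖errorBound α γ D t z n‖) ∧
      ∀ x, errorBound α γ D t z (n + h) x ≤
        (decay α x (t + n) h z + γ) * ‖errorBound α γ D t z n‖ := by
  set U := ‖errorBound α γ D t z n‖
  have hU : 0 ≤ U := norm_nonneg _
  induction h with
  | zero =>
    have h0 : ∀ x, errorBound α γ D t z (n + 0) x ≤ U := fun x =>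
      (le_abs_self _).trans (norm_le_pi_norm (errorBound α γ D t z n) x)
    refine ⟨h0, fun x => (h0 x).trans ?_⟩
    simp only [decay, Finset.range_zero, Finset.prod_empty]
    nlinarith
  | succ h ih =>
    have hn : ‖errorBound α γ D t z (n + h)‖ ≤ U :=
      (pi_norm_le_iff_of_nonneg hU).2 fun x => by
        rw [Real.norm_of_nonneg (errorBound_nonneg hα0 hα1 hγ0 hD _ _ _ _)]
        exact ih.1 x
    have hγU : γ * ‖errorBound α γ D t z (n + h)‖ ≤ γ * U :=
      mul_le_mul_of_nonneg_left hn hγ0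
    have hα1' : 0 ≤ 1 - α := sub_nonneg.2 hα1
    constructor
    · intro x
      rw [← add_assoc]
      simp only [errorBound]
      split_ifs
      · have h1 := mul_le_mul_of_nonneg_left (ih.1 x) hα1'
        have h2 : α * (γ * ‖errorBound α γ D t z (n + h)‖) ≤ α * U :=
          mul_le_mul_of_nonneg_left (hγU.trans (mul_le_of_le_one_left hU hγ1)) hα0
        linarith
      · exact ih.1 x
    · intro x
      rw [decay_succ, ← add_assoc n h 1]
      simp only [errorBound]
      rw [← add_assoc]
      by_cases hx : x = z (t + n + h)
      · rw [if_pos hx, if_pos hx.symm]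
        have h1 := mul_le_mul_of_nonneg_left (ih.2 x) hα1'
        have h2 := mul_le_mul_of_nonneg_left hγU hα0
        linarith
      · rw [if_neg hx, if_neg (Ne.symm hx), mul_one]
        exact ih.2 x

/-- The maximum over pairs is replaced by a sum, so that expectations can be taken pair by pair; the
cost, a factor `card (S × A)`, ends up inside a logarithm. -/
theorem norm_errorBound_add_le (hα0 : 0 ≤ α) (hα1 : α ≤ 1) (hγ0 : 0 ≤ γ) (hγ1 : γ ≤ 1)
    (hD : 0 ≤ D) (t n h : ℕ) (z : ℕ → X) :
    ‖errorBound α γ D t z (n + h)‖ ≤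
      ∑ x, decay α x (t + n) h z * ‖errorBound α γ D t z n‖ +
        γ * ‖errorBound α γ D t z n‖ := by
  have hd : ∀ x, 0 ≤ decay α x (t + n) h z * ‖errorBound α γ D t z n‖ := fun x =>
    mul_nonneg (decay_nonneg hα1 _ _ _ _) (norm_nonneg _)
  refine (pi_norm_le_iff_of_nonneg (add_nonneg (Finset.sum_nonneg fun x _ => hd x)
    (mul_nonneg hγ0 (norm_nonneg _)))).2 fun x => ?_
  rw [Real.norm_of_nonneg (errorBound_nonneg hα0 hα1 hγ0 hD _ _ _ _)]
  refine ((errorBound_add_le hα0 hα1 hγ0 hγ1 hD t n h z).2 x).trans ?_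
  rw [add_mul]
  gcongr
  exact Finset.single_le_sum (fun x _ => hd x) (Finset.mem_univ x)

end ErrorBound

/-! ### Averaged noise and the pathwise error bound -/

variable {S A : Type*} [Fintype S]

/-- Sampling noise of one step: `γ (V(s') - P V (x))`, where `V = max_a Q (·, a)`. -/
def MDP.noise (M : MDP S A) (Q : S × A → ℝ) (x : S × A) (s' : S) : ℝ :=
  M.γ * ((⨆ a, Q (s', a)) - ∑ s, M.P x.2 x.1 s * ⨆ a, Q (s, a))

variable [DecidableEq S] [DecidableEq A]

/-- One step of the exponentially weighted average of the noise at each pair. -/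
def MDP.noiseStep (M : MDP S A) (Q : S × A → ℝ) (α : ℝ) (w : S × A → ℝ) (y : S × A) (s' : S)
    (x : S × A) : ℝ :=
  if x = y then (1 - α) * w x + α * M.noise Q y s' else w x

/-- The exponentially weighted average of the noise at each pair from time `t` on. -/
def MDP.noiseAverage (M : MDP S A) (Q : S × A → ℝ) (α : ℝ) (t : ℕ) (z : ℕ → S × A) :
    ℕ → S × A → ℝ
  | 0 => 0
  | n + 1 => M.noiseStep Q α (M.noiseAverage Q α t z n) (z (t + n)) (z (t + n + 1)).1

theorem MDP.dependsOnPast_noiseAverage (M : MDP S A) (Q : S × A → ℝ) (α : ℝ) (t n : ℕ) :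
    DependsOnPast (t + n) fun z => M.noiseAverage Q α t z n := by
  intro z z' hz
  induction n with
  | zero => rfl
  | succ n ih =>
    have h := ih fun j hj => hz j (by omega)
    simp only at h
    simp only [MDP.noiseAverage]
    rw [h, hz (t + n) (by omega), hz (t + n + 1) (by omega)]

theorem MDP.dependsOnPast_qIterate (M : MDP S A) (α : ℕ → ℝ) (Q₀ : S × A → ℝ) (n : ℕ) :
    DependsOnPast n fun z => M.qIterate α Q₀ z n := by
  intro z z' hz
  induction n with
  | zero => rfl
  | succ n ih =>
    have h := ih fun j hj => hz j (by omega)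
    simp only at h
    funext x
    simp only [MDP.qIterate]
    rw [h, hz n (by omega), hz (n + 1) (by omega)]

variable [Fintype A] [Nonempty A]

/-- The ball of radius `b` is invariant since `1 + γ b ≤ b`. -/
theorem MDP.norm_qIterate_le (M : MDP S A) {α : ℝ} (hα0 : 0 ≤ α) (hα1 : α ≤ 1)
    {Q₀ : S × A → ℝ} {b : ℝ} (hb : 1 / (1 - M.γ) ≤ b) (hQ₀ : ‖Q₀‖ ≤ b) (z : ℕ → S × A) (n : ℕ) :
    ‖M.qIterate (fun _ => α) Q₀ z n‖ ≤ b := by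
  have hγ : 0 < 1 - M.γ := sub_pos.2 M.γ_lt_one
  have hb0 : 0 ≤ b := le_trans (by positivity) hb
  induction n with
  | zero => exact hQ₀
  | succ n ih =>
    refine (pi_norm_le_iff_of_nonneg hb0).2 fun x => ?_
    have h1 : ∀ x, |M.qIterate (fun _ => α) Q₀ z n x| ≤ b := fun x =>
      (norm_le_pi_norm _ x).trans ih
    simp only [MDP.qIterate]
    split_ifs with hx
    · have h2 : |⨆ a, M.qIterate (fun _ => α) Q₀ z n ((z (n + 1)).1, a)| ≤ b := by
        simpa using abs_iSup_sub_iSup_le (f := fun a =>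
          M.qIterate (fun _ => α) Q₀ z n ((z (n + 1)).1, a)) (g := fun _ => 0) (d := b)
          fun a => by simpa using h1 _
      have h3 := abs_le.1 (h1 x)
      have h4 := abs_le.1 h2
      have h5 := M.R_nonneg (z n)
      have h6 := M.R_le_one (z n)
      rw [div_le_iff₀ hγ] at hb
      have e : ∀ q v r : ℝ, q + α * (r + M.γ * v - q) = (1 - α) * q + α * (r + M.γ * v) :=
        fun q v r => by ring
      rw [MDP.temporalDifference, ← hx, e, Real.norm_eq_abs]
      have h7 := mul_le_mul_of_nonneg_left h4.1 M.γ_pos.le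
      have h8 := mul_le_mul_of_nonneg_left h4.2 M.γ_pos.le
      rw [← hx] at h5 h6
      set v := ⨆ a, M.qIterate (fun _ => α) Q₀ z n ((z (n + 1)).1, a)
      have h9 : M.R x + M.γ * v ≤ b := by linarith
      have h10 : -b ≤ M.R x + M.γ * v := by nlinarith
      have h11 := mul_le_mul_of_nonneg_left h9 hα0
      have h12 := mul_le_mul_of_nonneg_left h10 hα0
      have h13 := mul_le_mul_of_nonneg_left h3.1 (sub_nonneg.2 hα1)
      have h14 := mul_le_mul_of_nonneg_left h3.2 (sub_nonneg.2 hα1)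
      exact abs_le.2 ⟨by linarith, by linarith⟩
    · exact h1 x

/-- After `W` is subtracted, a visit averages the old remainder with `γ` times the error of the
values, which is at most `‖u‖ + N + c`. The constant `c = γ N / (1 - γ)` is the fixed point of `c =
γ (N + c)`, so it persists along the induction. -/
theorem MDP.abs_qIterate_sub_le (M : MDP S A) {α : ℝ} (hα0 : 0 ≤ α) (hα1 : α ≤ 1)
    {Q₀ Qs : S × A → ℝ} (hQs : M.IsBellmanOptimal Qs) {D : ℝ} (z : ℕ → S × A) (t : ℕ)
    (hD : ‖M.qIterate (fun _ => α) Q₀ z t - Qs‖ ≤ D) {K : ℕ} {N : ℝ}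
    (hN : ∀ n ≤ K, ‖M.noiseAverage Qs α t z n‖ ≤ N) {n : ℕ} (hn : n ≤ K) (x : S × A) :
    |M.qIterate (fun _ => α) Q₀ z (t + n) x - Qs x - M.noiseAverage Qs α t z n x| ≤
      errorBound α M.γ D t z n x + M.γ * N / (1 - M.γ) := by
  have hγ : 0 < 1 - M.γ := sub_pos.2 M.γ_lt_one
  have hγ0 := M.γ_pos
  have hN0 : 0 ≤ N := (norm_nonneg _).trans (hN 0 (Nat.zero_le _))
  have hD0 : 0 ≤ D := (norm_nonneg _).trans hD
  have hNd : 0 ≤ M.γ * N / (1 - M.γ) := by positivity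
  induction n generalizing x with
  | zero =>
    simp only [MDP.noiseAverage, errorBound, add_zero, Pi.zero_apply, sub_zero]
    have := (norm_le_pi_norm (M.qIterate (fun _ => α) Q₀ z t - Qs) x).trans hD
    rw [Pi.sub_apply, Real.norm_eq_abs] at this
    linarith
  | succ n ih =>
    specialize ih (by omega)
    rw [← add_assoc]
    simp only [MDP.qIterate, MDP.noiseAverage, MDP.noiseStep, errorBound]
    set Q := M.qIterate (fun _ => α) Q₀ z (t + n)
    set W := M.noiseAverage Qs α t z n
    set u := errorBound α M.γ D t z n
    split_ifs with hx
    · have hV : |(⨆ a, Q ((z (t + n + 1)).1, a)) - ⨆ a, Qs ((z (t + n + 1)).1, a)| ≤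
          ‖u‖ + N / (1 - M.γ) := by
        refine abs_iSup_sub_iSup_le fun a => ?_
        set y := ((z (t + n + 1)).1, a)
        have h1 := abs_le.1 (ih y)
        have h2 : |W y| ≤ N := (norm_le_pi_norm W y).trans (hN n (by omega))
        have h2 := abs_le.1 h2
        have h3 : u y ≤ ‖u‖ := (le_abs_self _).trans (norm_le_pi_norm u y)
        have h4 : N / (1 - M.γ) = N + M.γ * N / (1 - M.γ) := by field_simp; ring
        rw [h4]
        exact abs_le.2 ⟨by linarith, by linarith⟩
      have hQ := hQs x
      have e : Q x + α * M.temporalDifference Q (z (t + n)) (z (t + n + 1)).1 - Qs x -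
          ((1 - α) * W x + α * M.noise Qs (z (t + n)) (z (t + n + 1)).1) =
          (1 - α) * (Q x - Qs x - W x) + α * (M.γ *
            ((⨆ a, Q ((z (t + n + 1)).1, a)) - ⨆ a, Qs ((z (t + n + 1)).1, a))) := by
        rw [MDP.temporalDifference, MDP.noise, ← hx]
        linear_combination (-α) * hQ
      rw [e]
      refine (abs_add_le _ _).trans ?_
      rw [abs_mul, abs_mul, abs_mul, abs_of_nonneg (sub_nonneg.2 hα1), abs_of_nonneg hα0,
        abs_of_pos hγ0]
      have h1 := mul_le_mul_of_nonneg_left (ih x) (sub_nonneg.2 hα1)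
      have h2 := mul_le_mul_of_nonneg_left (mul_le_mul_of_nonneg_left hV hγ0.le) hα0
      refine (add_le_add h1 h2).trans (le_of_eq ?_)
      ring
    · exact ih x

theorem MDP.norm_qIterate_sub_le (M : MDP S A) {α : ℝ} (hα0 : 0 ≤ α) (hα1 : α ≤ 1)
    {Q₀ Qs : S × A → ℝ} (hQs : M.IsBellmanOptimal Qs) {D : ℝ} (z : ℕ → S × A) (t : ℕ)
    (hD : ‖M.qIterate (fun _ => α) Q₀ z t - Qs‖ ≤ D) {K : ℕ} {N : ℝ}
    (hN : ∀ n ≤ K, ‖M.noiseAverage Qs α t z n‖ ≤ N) :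
    ‖M.qIterate (fun _ => α) Q₀ z (t + K) - Qs‖ ≤
      ‖errorBound α M.γ D t z K‖ + N / (1 - M.γ) := by
  have hγ : 0 < 1 - M.γ := sub_pos.2 M.γ_lt_one
  have hN0 : 0 ≤ N := (norm_nonneg _).trans (hN 0 (Nat.zero_le _))
  refine (pi_norm_le_iff_of_nonneg (by positivity)).2 fun x => ?_
  have h1 := abs_le.1 (M.abs_qIterate_sub_le hα0 hα1 hQs z t hD hN le_rfl x)
  have h2 := abs_le.1 ((norm_le_pi_norm _ x).trans (hN K le_rfl))
  have h3 := (le_abs_self _).trans (norm_le_pi_norm (errorBound α M.γ D t z K) x)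
  have h4 : N / (1 - M.γ) = N + M.γ * N / (1 - M.γ) := by field_simp; ring
  rw [Pi.sub_apply, Real.norm_eq_abs, h4]
  exact abs_le.2 ⟨by linarith, by linarith⟩

end Decomposition

/-! ### Expected size of the comparison process -/

section ExpectedErrorBound

variable {S A Ω : Type*} [Fintype S] [DecidableEq S] [Fintype A] [DecidableEq A]
  [MeasurableSpace S] [MeasurableSpace A]
  [DiscreteMeasurableSpace S] [DiscreteMeasurableSpace A] [MeasurableSpace Ω]
  {M : MDP S A} {π : Policy S A} {μ : Measure Ω} [IsProbabilityMeasure μ] {Z : ℕ → Ω → S × A}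

theorem IsTrajectory.integral_norm_errorBound_le (hZ : IsTrajectory M π μ Z) {α D : ℝ}
    (hα0 : 0 ≤ α) (hα1 : α ≤ 1) (hD : 0 ≤ D) {p : ℝ} {r : ℕ}
    (hp : ∀ x y, p ≤ ((fun f x => ∑ y, M.trans π x y * f y)^[r] (Pi.single x 1)) y)
    (hp1 : α * p ≤ 1) (t m k : ℕ) :
    ∫ ω, ‖errorBound α M.γ D t (fun i => Z i ω) (k * (m * (r + 1)))‖ ∂μ ≤
      (Fintype.card (S × A) * (1 - α * p) ^ m + M.γ) ^ k * D := by
  set c := Fintype.card (S × A) * (1 - α * p) ^ m + M.γ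
  have hc : 0 ≤ c := add_nonneg (mul_nonneg (Nat.cast_nonneg _)
    (pow_nonneg (sub_nonneg.2 hp1) _)) M.γ_pos.le
  induction k with
  | zero =>
    rw [zero_mul, pow_zero, one_mul]
    have h : ∀ ω, ‖errorBound α M.γ D t (fun i => Z i ω) 0‖ ≤ D := fun ω =>
      (pi_norm_le_iff_of_nonneg hD).2 fun x => (Real.norm_of_nonneg hD).le
    calc _ ≤ ∫ _, D ∂μ := integral_mono
          (hZ.integrable (i := t) (G := fun z => ‖errorBound α M.γ D t z 0‖)
            fun z z' hz => by simp only [dependsOnPast_errorBound t 0 z z' hz])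
          (integrable_const D) h
      _ = D := by simp
  | succ k ih =>
    set n := k * (m * (r + 1))
    have hU : ∀ n, DependsOnPast (t + n) fun z : ℕ → S × A => ‖errorBound α M.γ D t z n‖ :=
      fun n z z' hz => by simp only [dependsOnPast_errorBound t n z z' hz]
    have hd : ∀ x, DependsOnPast (t + n + m * (r + 1)) fun z : ℕ → S × A =>
        decay α x (t + n) (m * (r + 1)) z * ‖errorBound α M.γ D t z n‖ := fun x z z' hz => by
      have h1 := hU n z z' fun j hj => hz j (by omega)
      simp only at h1 ⊢
      rw [h1, dependsOnPast_decay x (t + n) _ z z' hz]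
    have hstep : ∫ ω, ‖errorBound α M.γ D t (fun i => Z i ω) (n + m * (r + 1))‖ ∂μ ≤
        ∫ ω, (∑ x, decay α x (t + n) (m * (r + 1)) (fun i => Z i ω) *
          ‖errorBound α M.γ D t (fun i => Z i ω) n‖ +
            M.γ * ‖errorBound α M.γ D t (fun i => Z i ω) n‖) ∂μ :=
      integral_mono (hZ.integrable (hU _))
        ((integrable_finsetSum _ fun x _ => hZ.integrable (hd x)).add
          ((hZ.integrable (hU n)).const_mul _))
        fun ω => norm_errorBound_add_le hα0 hα1 M.γ_pos.le M.γ_lt_one.le hD t n _ _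
    rw [integral_add (integrable_finsetSum _ fun x _ => hZ.integrable (hd x))
      ((hZ.integrable (hU n)).const_mul _), integral_finsetSum _ fun x _ => hZ.integrable (hd x),
      integral_const_mul] at hstep
    have hsum := Finset.sum_le_sum fun x (_ : x ∈ (Finset.univ : Finset (S × A))) =>
      hZ.integral_decay_mul_le hα0 hα1 (hp x) hp1 (hU n) (fun z => norm_nonneg _) m
    rw [Finset.sum_const, Finset.card_univ, nsmul_eq_mul] at hsum
    rw [show (k + 1) * (m * (r + 1)) = n + m * (r + 1) by ring, pow_succ', mul_assoc]
    refine le_trans ?_ (mul_le_mul_of_nonneg_left ih hc)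
    simp only [c]
    linarith

end ExpectedErrorBound

/-! ### Exponential moments of the averaged noise -/

section ExponentialMoments

/-- Hoeffding's lemma for a symmetric interval and a finite distribution. -/
theorem sum_mul_exp_le {X : Type*} [Fintype X] {p ξ : X → ℝ} (hp : ∀ x, 0 ≤ p x)
    (h1 : ∑ x, p x = 1) (h0 : ∑ x, p x * ξ x = 0) {σ : ℝ} (hσ : 0 < σ)
    (hξ : ∀ x, |ξ x| ≤ σ) (θ : ℝ) :
    ∑ x, p x * Real.exp (θ * ξ x) ≤ Real.exp ((θ * σ) ^ 2 / 2) := by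
  -- On `[-σ, σ]` the exponential lies below its chord; the linear part of the chord vanishes in the
  -- mean and the constant part is a `cosh`.
  have hx : ∀ x, Real.exp (θ * ξ x) ≤
      (Real.exp (θ * σ) + Real.exp (-(θ * σ))) / 2 +
        ξ x * ((Real.exp (θ * σ) - Real.exp (-(θ * σ))) / (2 * σ)) := by
    intro x
    have hb := abs_le.1 (hξ x)
    have h := convexOn_exp.2 (Set.mem_univ (θ * σ)) (Set.mem_univ (-(θ * σ)))
      (show 0 ≤ (σ + ξ x) / (2 * σ) from div_nonneg (by linarith) (by linarith))
      (show 0 ≤ (σ - ξ x) / (2 * σ) from div_nonneg (by linarith) (by linarith))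
      (by field_simp; ring)
    simp only [smul_eq_mul] at h
    have e1 : (σ + ξ x) / (2 * σ) * (θ * σ) + (σ - ξ x) / (2 * σ) * -(θ * σ) = θ * ξ x := by
      field_simp; ring
    rw [e1] at h
    refine h.trans (le_of_eq ?_)
    field_simp
    ring
  calc ∑ x, p x * Real.exp (θ * ξ x) ≤ ∑ x, p x *
        ((Real.exp (θ * σ) + Real.exp (-(θ * σ))) / 2 +
        ξ x * ((Real.exp (θ * σ) - Real.exp (-(θ * σ))) / (2 * σ))) :=
        Finset.sum_le_sum fun x _ => mul_le_mul_of_nonneg_left (hx x) (hp x)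
    _ = Real.cosh (θ * σ) := by
        simp_rw [mul_add, Finset.sum_add_distrib, ← mul_assoc, ← Finset.sum_mul]
        rw [h1, h0, Real.cosh_eq]
        ring
    _ ≤ _ := Real.cosh_le_exp_half_sq _

variable {S A : Type*} [Fintype S]

theorem MDP.dependsOnPast_sum_exp {S A : Type*} [Fintype S] [Fintype A]
    [DecidableEq S] [DecidableEq A] (M : MDP S A) (Q : S × A → ℝ) (α θ : ℝ) (t n : ℕ) :
    DependsOnPast (t + n) fun z => ∑ x, Real.exp (θ * M.noiseAverage Q α t z n x) :=
  fun z z' hz => by simp only [M.dependsOnPast_noiseAverage Q α t n z z' hz]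

theorem MDP.sum_mul_noise (M : MDP S A) (Q : S × A → ℝ) (x : S × A) :
    ∑ s', M.P x.2 x.1 s' * M.noise Q x s' = 0 := by
  have h : ∀ s', M.P x.2 x.1 s' * M.noise Q x s' =
      M.γ * (M.P x.2 x.1 s' * ⨆ a, Q (s', a)) -
        M.P x.2 x.1 s' * (M.γ * ∑ s, M.P x.2 x.1 s * ⨆ a, Q (s, a)) := fun s' => by
    rw [MDP.noise]; ring
  rw [Finset.sum_congr rfl fun s' _ => h s', Finset.sum_sub_distrib, ← Finset.mul_sum,
    ← Finset.sum_mul, M.P_sum]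
  ring

variable [Fintype A]

theorem MDP.IsBellmanOptimal.abs_noise_le [Nonempty S] [Nonempty A] {M : MDP S A}
    {Q : S × A → ℝ} (hQ : M.IsBellmanOptimal Q) (x : S × A) (s' : S) :
    |M.noise Q x s'| ≤ 1 / (1 - M.γ) := by
  have hγ : 0 < 1 - M.γ := sub_pos.2 M.γ_lt_one
  have hV : ∀ s, 0 ≤ (⨆ a, Q (s, a)) ∧ (⨆ a, Q (s, a)) ≤ 1 / (1 - M.γ) := fun s =>
    ⟨Real.iSup_nonneg fun a => (hQ.nonneg_and_le _).1, ciSup_le fun a => (hQ.nonneg_and_le _).2⟩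
  have h1 : ∑ s, M.P x.2 x.1 s * (⨆ a, Q (s, a)) ≤ 1 / (1 - M.γ) :=
    sum_mul_le_of_le (M.P_nonneg _ _) (M.P_sum _ _) fun s => (hV s).2
  have h2 : 0 ≤ ∑ s, M.P x.2 x.1 s * (⨆ a, Q (s, a)) :=
    Finset.sum_nonneg fun s _ => mul_nonneg (M.P_nonneg _ _ _) (hV s).1
  rw [MDP.noise, abs_mul, abs_of_pos M.γ_pos]
  refine (mul_le_of_le_one_left (abs_nonneg _) M.γ_lt_one.le).trans ?_
  exact abs_le.2 ⟨by linarith [(hV s').1], by linarith [(hV s').2]⟩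

variable [DecidableEq S] [DecidableEq A]

/-- Hoeffding's lemma bounds the noise factor by `exp(α l)`, and convexity gives `exp((1 - α) θ w +
α l) ≤ (1 - α) exp(θ w) + α exp(l)`. Only the entry `y` pays the extra term, so the sum grows
additively and not by a factor. -/
theorem MDP.IsBellmanOptimal.sum_exp_noiseStep_le [Nonempty S] [Nonempty A] {M : MDP S A}
    {Q : S × A → ℝ} (hQ : M.IsBellmanOptimal Q) {α θ l : ℝ} (hα0 : 0 < α) (hα1 : α ≤ 1)
    (hl : θ ^ 2 * α * (1 / (1 - M.γ)) ^ 2 / 2 ≤ l) (w : S × A → ℝ) (y : S × A) :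
    ∑ s', M.P y.2 y.1 s' * ∑ x, Real.exp (θ * M.noiseStep Q α w y s' x) ≤
      ∑ x, Real.exp (θ * w x) + α * Real.exp l := by
  have hγ : 0 < 1 - M.γ := sub_pos.2 M.γ_lt_one
  have hx : ∀ x, ∑ s', M.P y.2 y.1 s' * Real.exp (θ * M.noiseStep Q α w y s' x) ≤
      Real.exp (θ * w x) + if x = y then α * Real.exp l else 0 := by
    intro x
    unfold MDP.noiseStep
    split_ifs with hxy
    · have h1 := sum_mul_exp_le (M.P_nonneg y.2 y.1) (M.P_sum y.2 y.1) (M.sum_mul_noise Q y)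
        (by positivity) (hQ.abs_noise_le y) (θ * α)
      have h2 : ∀ s', M.P y.2 y.1 s' * Real.exp (θ * ((1 - α) * w x + α * M.noise Q y s')) =
          Real.exp ((1 - α) * (θ * w x)) * (M.P y.2 y.1 s' *
            Real.exp (θ * α * M.noise Q y s')) := fun s' => by
        rw [show θ * ((1 - α) * w x + α * M.noise Q y s') =
          (1 - α) * (θ * w x) + θ * α * M.noise Q y s' by ring, Real.exp_add]
        ring
      rw [Finset.sum_congr rfl fun s' _ => h2 s', ← Finset.mul_sum]
      have h3 : (θ * α * (1 / (1 - M.γ))) ^ 2 / 2 ≤ α * l := by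
        have := mul_le_mul_of_nonneg_left hl hα0.le
        refine le_trans (le_of_eq ?_) this
        ring
      have h4 := convexOn_exp.2 (Set.mem_univ (θ * w x)) (Set.mem_univ l)
        (sub_nonneg.2 hα1) hα0.le (by ring)
      simp only [smul_eq_mul] at h4
      calc _ ≤ Real.exp ((1 - α) * (θ * w x)) * Real.exp (α * l) :=
            mul_le_mul_of_nonneg_left (h1.trans (Real.exp_le_exp.2 h3)) (Real.exp_pos _).le
        _ = Real.exp ((1 - α) * (θ * w x) + α * l) := (Real.exp_add _ _).symm
        _ ≤ _ := h4
        _ ≤ _ := by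
          gcongr
          exact mul_le_of_le_one_left (Real.exp_pos _).le (by linarith)
    · rw [← Finset.sum_mul, M.P_sum, one_mul, add_zero]
  simp_rw [Finset.mul_sum]
  rw [Finset.sum_comm]
  refine (Finset.sum_le_sum fun x _ => hx x).trans (le_of_eq ?_)
  rw [Finset.sum_add_distrib]
  simp

variable {Ω : Type*} [MeasurableSpace S] [MeasurableSpace A]
  [DiscreteMeasurableSpace S] [DiscreteMeasurableSpace A] [MeasurableSpace Ω]
  {M : MDP S A} {π : Policy S A} {μ : Measure Ω} [IsProbabilityMeasure μ] {Z : ℕ → Ω → S × A}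

theorem IsTrajectory.integral_sum_exp_le [Nonempty S] [Nonempty A] (hZ : IsTrajectory M π μ Z)
    {Q : S × A → ℝ} (hQ : M.IsBellmanOptimal Q) {α θ l : ℝ} (hα0 : 0 < α) (hα1 : α ≤ 1)
    (hl : θ ^ 2 * α * (1 / (1 - M.γ)) ^ 2 / 2 ≤ l) (t n : ℕ) :
    ∫ ω, ∑ x, Real.exp (θ * M.noiseAverage Q α t (fun i => Z i ω) n x) ∂μ ≤
      Fintype.card (S × A) + n * (α * Real.exp l) := by
  induction n with
  | zero => simp [MDP.noiseAverage]
  | succ n ih =>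
    have hΦ : DependsOnPast (t + n) fun (z : ℕ → S × A) (y : S × A) =>
        ∑ x, Real.exp (θ * M.noiseStep Q α (M.noiseAverage Q α t z n) (z (t + n)) y.1 x) :=
      fun z z' hz => by
        simp only [M.dependsOnPast_noiseAverage Q α t n z z' hz, hz (t + n) le_rfl]
    have hΦ' : DependsOnPast (t + n) fun z : ℕ → S × A => ∑ y : S × A, M.trans π (z (t + n)) y *
        ∑ x, Real.exp (θ * M.noiseStep Q α (M.noiseAverage Q α t z n) (z (t + n)) y.1 x) :=
      fun z z' hz => by
        simp only [M.dependsOnPast_noiseAverage Q α t n z z' hz, hz (t + n) le_rfl]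
    simp only [MDP.noiseAverage]
    rw [hZ.integral_succ hΦ]
    have hint := hZ.integrable (M.dependsOnPast_sum_exp Q α θ t n)
    calc _ ≤ ∫ ω, (∑ x, Real.exp (θ * M.noiseAverage Q α t (fun i => Z i ω) n x) +
          α * Real.exp l) ∂μ := by
          refine integral_mono (hZ.integrable hΦ') (hint.add (integrable_const _)) fun ω => ?_
          simp only
          rw [M.sum_trans_mul]
          simp only
          simp_rw [← Finset.sum_mul, π.sum_eq_one, one_mul]
          exact hQ.sum_exp_noiseStep_le hα0 hα1 hl _ _
      _ ≤ _ := by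
          rw [integral_add hint (integrable_const _), integral_const]
          simp only [probReal_univ, one_smul, Nat.cast_add, Nat.cast_one]
          linarith

/-- Jensen's inequality, by way of the tangent line of the logarithm at `b`. -/
theorem integral_log_le {μ : Measure Ω} [IsProbabilityMeasure μ] {F : Ω → ℝ}
    (hF : Integrable F μ) (hlog : Integrable (fun ω => Real.log (F ω)) μ)
    (hpos : ∀ ω, 0 < F ω) {b : ℝ} (hb : 0 < b) (h : ∫ ω, F ω ∂μ ≤ b) :
    ∫ ω, Real.log (F ω) ∂μ ≤ Real.log b := by
  have h1 : ∀ ω, Real.log (F ω) ≤ Real.log b + (F ω / b - 1) := fun ω => by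
    have := Real.log_le_sub_one_of_pos (div_pos (hpos ω) hb)
    rw [Real.log_div (hpos ω).ne' hb.ne'] at this
    linarith
  calc ∫ ω, Real.log (F ω) ∂μ ≤ ∫ ω, (Real.log b + (F ω / b - 1)) ∂μ :=
        integral_mono hlog ((integrable_const _).add ((hF.div_const b).sub (integrable_const _))) h1
    _ = Real.log b + ((∫ ω, F ω ∂μ) / b - 1) := by
        have h2 : Integrable (fun ω => F ω / b - 1) μ := (hF.div_const b).sub (integrable_const _)
        rw [integral_add (integrable_const _) h2, integral_sub (hF.div_const b) (integrable_const _), integral_div]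
        simp
    _ ≤ Real.log b := by
        have : (∫ ω, F ω ∂μ) / b ≤ 1 := (div_le_one hb).2 h
        linarith

/-- Finite-time bound for the error of asynchronous `Q`-learning, `K` steps after time `t`. -/
theorem IsTrajectory.integral_norm_qIterate_sub_le [Nonempty S] [Nonempty A]
    (hZ : IsTrajectory M π μ Z) {Q₀ Qs : S × A → ℝ} (hQs : M.IsBellmanOptimal Qs)
    {α θ l D : ℝ} (hα0 : 0 < α) (hα1 : α ≤ 1) (hθ : 0 < θ) (hl0 : 0 ≤ l)
    (hl : θ ^ 2 * α * (1 / (1 - M.γ)) ^ 2 / 2 ≤ l) {t K : ℕ}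
    (hD : ∀ z, ‖M.qIterate (fun _ => α) Q₀ z t - Qs‖ ≤ D) :
    ∫ ω, ‖M.qIterate (fun _ => α) Q₀ (fun i => Z i ω) (t + K) - Qs‖ ∂μ ≤
      ∫ ω, ‖errorBound α M.γ D t (fun i => Z i ω) K‖ ∂μ +
        (l + Real.log (2 * (K + 1) * (Fintype.card (S × A) + K))) / (θ * (1 - M.γ)) := by
  have hγ : 0 < 1 - M.γ := sub_pos.2 M.γ_lt_one
  -- `F` dominates `exp(θ |W_n(x)|)` for all times `n ≤ K` and all `x` at once, so `log F / θ`
  -- bounds the largest noise average along the path.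
  set F : (ℕ → S × A) → ℝ := fun z => ∑ n ∈ Finset.range (K + 1),
    (∑ x, Real.exp (θ * M.noiseAverage Qs α t z n x) +
      ∑ x, Real.exp (-θ * M.noiseAverage Qs α t z n x)) with hFdef
  have hFpast : DependsOnPast (t + K) F := fun z z' hz => Finset.sum_congr rfl fun n hn => by
    have hn := Finset.mem_range.1 hn
    have h := M.dependsOnPast_noiseAverage Qs α t n z z' fun j hj => hz j (by omega)
    simp only at h
    rw [h]
  have hexp : ∀ z, ∀ n ≤ K, ∀ x, Real.exp (θ * |M.noiseAverage Qs α t z n x|) ≤ F z := by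
    intro z n hn x
    refine le_trans ?_ (Finset.single_le_sum (f := fun n =>
      (∑ x, Real.exp (θ * M.noiseAverage Qs α t z n x) +
        ∑ x, Real.exp (-θ * M.noiseAverage Qs α t z n x))) (fun n _ => by positivity)
      (Finset.mem_range.2 (Nat.lt_succ_of_le hn)))
    have h1 := Finset.single_le_sum (f := fun x =>
      Real.exp (θ * M.noiseAverage Qs α t z n x)) (fun x _ => (Real.exp_pos _).le)
      (Finset.mem_univ x)
    have h2 := Finset.single_le_sum (f := fun x =>
      Real.exp (-θ * M.noiseAverage Qs α t z n x)) (fun x _ => (Real.exp_pos _).le)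
      (Finset.mem_univ x)
    rcases abs_cases (M.noiseAverage Qs α t z n x) with ⟨h, _⟩ | ⟨h, _⟩
    · rw [h]
      exact h1.trans (le_add_of_nonneg_right (by positivity))
    · rw [h, mul_neg, ← neg_mul]
      exact h2.trans (le_add_of_nonneg_left (by positivity))
  have hFpos : ∀ z, 0 < F z := fun z => by
    obtain ⟨x⟩ : Nonempty (S × A) := inferInstance
    exact (Real.exp_pos _).trans_le (hexp z 0 (Nat.zero_le _) x)
  have hN : ∀ z, ∀ n ≤ K, ‖M.noiseAverage Qs α t z n‖ ≤ Real.log (F z) / θ := by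
    intro z n hn
    refine (pi_norm_le_iff_of_nonempty _).2 fun x => ?_
    rw [le_div_iff₀ hθ, mul_comm, Real.norm_eq_abs]
    exact (Real.le_log_iff_exp_le (hFpos z)).2 (hexp z n hn x)
  have hpt : ∀ z, ‖M.qIterate (fun _ => α) Q₀ z (t + K) - Qs‖ ≤
      ‖errorBound α M.γ D t z K‖ + Real.log (F z) / (θ * (1 - M.γ)) := fun z => by
    have := M.norm_qIterate_sub_le hα0.le hα1 hQs z t (hD z) (hN z)
    rwa [div_div] at this
  have hFint := hZ.integrable hFpast
  have hlogint : Integrable (fun ω => Real.log (F fun i => Z i ω)) μ :=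
    hZ.integrable (i := t + K) (G := fun z => Real.log (F z)) fun z z' hz => by simp only [hFpast z z' hz]
  have hEint : Integrable (fun ω => ‖errorBound α M.γ D t (fun i => Z i ω) K‖) μ :=
    hZ.integrable (i := t + K) (G := fun z => ‖errorBound α M.γ D t z K‖)
      fun z z' hz => by simp only [dependsOnPast_errorBound t K z z' hz]
  have hQint : Integrable (fun ω => ‖M.qIterate (fun _ => α) Q₀ (fun i => Z i ω) (t + K) - Qs‖) μ :=
    hZ.integrable (i := t + K) (G := fun z => ‖M.qIterate (fun _ => α) Q₀ z (t + K) - Qs‖)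
      fun z z' hz => by simp only [M.dependsOnPast_qIterate _ Q₀ (t + K) z z' hz]
  have hcard : (1 : ℝ) ≤ Fintype.card (S × A) := by exact_mod_cast Fintype.card_pos
  have he : 1 ≤ Real.exp l := Real.one_le_exp hl0
  have hFbound : ∫ ω, F (fun i => Z i ω) ∂μ ≤
      2 * (K + 1) * (Fintype.card (S × A) + K) * Real.exp l := by
    simp only [hFdef]
    have hi : ∀ θ n, Integrable
        (fun ω => ∑ x, Real.exp (θ * M.noiseAverage Qs α t (fun i => Z i ω) n x)) μ :=
      fun θ n => hZ.integrable (M.dependsOnPast_sum_exp Qs α θ t n)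
    have hi2 : ∀ n, Integrable
        (fun ω => ∑ x, Real.exp (θ * M.noiseAverage Qs α t (fun i => Z i ω) n x) +
          ∑ x, Real.exp (-θ * M.noiseAverage Qs α t (fun i => Z i ω) n x)) μ :=
      fun n => (hi θ n).add (hi (-θ) n)
    rw [integral_finsetSum _ fun n _ => hi2 n]
    have hn : ∀ n ∈ Finset.range (K + 1),
        ∫ ω, (∑ x, Real.exp (θ * M.noiseAverage Qs α t (fun i => Z i ω) n x) +
          ∑ x, Real.exp (-θ * M.noiseAverage Qs α t (fun i => Z i ω) n x)) ∂μ ≤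
        2 * (Fintype.card (S × A) + K) * Real.exp l := by
      intro n hn
      rw [integral_add (hi θ n) (hi (-θ) n)]
      have h1 := hZ.integral_sum_exp_le hQs hα0 hα1 hl t n
      have h2 := hZ.integral_sum_exp_le hQs hα0 hα1 (θ := -θ) (l := l) (by rwa [neg_sq]) t n
      have hnK : (n : ℝ) ≤ K := by exact_mod_cast Nat.lt_succ_iff.1 (Finset.mem_range.1 hn)
      have h3 : α * Real.exp l ≤ Real.exp l := mul_le_of_le_one_left (Real.exp_pos _).le hα1
      have h4 : n * (α * Real.exp l) ≤ K * Real.exp l :=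
        mul_le_mul hnK h3 (by positivity) (Nat.cast_nonneg _)
      have h5 : (Fintype.card (S × A) : ℝ) ≤ Fintype.card (S × A) * Real.exp l :=
        le_mul_of_one_le_right (by positivity) he
      linarith
    refine (Finset.sum_le_sum hn).trans (le_of_eq ?_)
    rw [Finset.sum_const, Finset.card_range, nsmul_eq_mul]
    push_cast
    ring
  have hb : (0 : ℝ) < 2 * (K + 1) * (Fintype.card (S × A) + K) := by positivity
  have hlog := integral_log_le hFint hlogint (fun ω => hFpos _) (by positivity) hFbound
  rw [Real.log_mul hb.ne' (Real.exp_pos _).ne', Real.log_exp] at hlog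
  refine (integral_mono hQint (hEint.add (hlogint.div_const _)) fun ω => hpt _).trans ?_
  simp only [Pi.add_apply]
  rw [integral_add hEint (hlogint.div_const _), integral_div]
  gcongr
  linarith

end ExponentialMoments

/-! ### Choice of the parameters -/

section Parameters

theorem one_sub_pow_le_exp {x : ℝ} (hx : x ≤ 1) (n : ℕ) : (1 - x) ^ n ≤ Real.exp (-(n * x)) := by
  have h := pow_le_pow_left₀ (sub_nonneg.2 hx) (Real.one_sub_le_exp_neg x) n
  rwa [← Real.exp_nat_mul, mul_neg] at h

theorem exists_half_pow_le {N : ℝ} (hN0 : 0 < N) (hN1 : N ≤ 1) :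
    ∃ j : ℕ, (1 / 2 : ℝ) ^ j ≤ N / 2 ∧ (j : ℝ) ≤ 3 * (1 + Real.log (1 / N)) := by
  have hlog : 0 ≤ Real.log (1 / N) := Real.log_nonneg (by rw [le_div_iff₀ hN0]; linarith)
  have h2 : Real.log (2 / N) = Real.log 2 + Real.log (1 / N) := by
    rw [← Real.log_mul (by norm_num) (by positivity)]; ring_nf
  have hl2 := Real.log_two_gt_d9
  have hl2' := Real.log_two_lt_d9
  refine ⟨⌈2 * Real.log (2 / N)⌉₊, ?_, ?_⟩
  · have h := one_sub_pow_le_exp (x := 1 / 2) (by norm_num) ⌈2 * Real.log (2 / N)⌉₊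
    rw [show (1 : ℝ) - 1 / 2 = 1 / 2 by norm_num] at h
    refine h.trans ?_
    have h3 : N / 2 = Real.exp (-Real.log (2 / N)) := by
      rw [Real.exp_neg, Real.exp_log (by positivity), inv_div]
    rw [h3]
    refine Real.exp_le_exp.2 ?_
    linarith [Nat.le_ceil (2 * Real.log (2 / N))]
  · refine (Nat.ceil_lt_add_one (by rw [h2]; linarith)).le.trans ?_
    rw [h2]
    linarith

theorem exists_mul_one_sub_pow_le {a x : ℝ} {d : ℝ} (ha : 0 < a) (hx0 : 0 < x) (hx1 : x ≤ 1)
    (hd : 0 < d) (had : d ≤ a) :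
    ∃ m : ℕ, a * (1 - x) ^ m ≤ d ∧ (m : ℝ) ≤ (1 + Real.log (a / d)) / x := by
  have hlog : 0 ≤ Real.log (a / d) := Real.log_nonneg (by rwa [le_div_iff₀ hd, one_mul])
  refine ⟨⌈Real.log (a / d) / x⌉₊, ?_, ?_⟩
  · have h := one_sub_pow_le_exp hx1 ⌈Real.log (a / d) / x⌉₊
    have h1 := (div_le_iff₀ hx0).1 (Nat.le_ceil (Real.log (a / d) / x))
    have h2 : Real.exp (-(⌈Real.log (a / d) / x⌉₊ * x)) ≤ d / a := by
      have h3 : d / a = Real.exp (-Real.log (a / d)) := by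
        rw [Real.exp_neg, Real.exp_log (by positivity), inv_div]
      rw [h3]
      exact Real.exp_le_exp.2 (by linarith)
    have h3 := mul_le_mul_of_nonneg_left (h.trans h2) ha.le
    rwa [mul_div_cancel₀ _ ha.ne'] at h3
  · refine (Nat.ceil_lt_add_one (by positivity)).le.trans ?_
    have : 1 ≤ 1 / x := by rwa [le_div_iff₀ hx0, one_mul]
    rw [add_div]
    linarith

theorem log_one_div_bounds {x : ℝ} (h0 : 0 < x) (h1 : x ≤ 1) :
    0 ≤ Real.log (1 / x) ∧ 1 + Real.log (1 / x) ≤ 1 / x := by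
  refine ⟨Real.log_nonneg (by rwa [le_div_iff₀ h0, one_mul]), ?_⟩
  linarith [Real.log_le_sub_one_of_pos (show 0 < 1 / x by positivity)]

theorem add_sub_one_le_mul {x y : ℝ} (hx : 1 ≤ x) (hy : 1 ≤ y) : x + y - 1 ≤ x * y := by
  nlinarith

theorem log_le_quarter_add_one {x : ℝ} (hx : 0 < x) : Real.log x ≤ x / 4 + 1 := by
  have h1 := Real.log_le_sub_one_of_pos (show 0 < x / 4 by positivity)
  have h2 : Real.log 4 = 2 * Real.log 2 := by
    rw [show (4 : ℝ) = 2 ^ 2 by norm_num, Real.log_pow]; norm_num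
  rw [Real.log_div hx.ne' (by norm_num), h2] at h1
  linarith [Real.log_two_lt_d9]

/-- Each factor is at most a power of `Y = max(1, 1 / ε) / (g N)`, so the argument of the logarithm
is at most `8 c² Y ^ 16`. The constant `19` is `16` from the exponent plus `3 ≥ log 8`. -/
theorem log_union_le {ε g N c R : ℝ} (hε : 0 < ε) (hg0 : 0 < g) (hg1 : g ≤ 1) (hN0 : 0 < N)
    (hN1 : N ≤ 1) (hc : 1 ≤ c) (hR0 : 0 ≤ R)
    (hR : R ≤ c * ((max 1 (Real.log (1 / ε))) ^ 2 / ε ^ 2)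
        * ((1 + Real.log (1 / g)) ^ 3 / g ^ 5) * ((1 + Real.log (1 / N)) ^ 3 / N)) :
    Real.log (2 * (R + 1) * (1 / N + R)) ≤ (19 + 2 * Real.log c) *
      (max 1 (Real.log (1 / ε)) * (1 + Real.log (1 / g)) * (1 + Real.log (1 / N))) := by
  obtain ⟨hg2, hg3⟩ := log_one_div_bounds hg0 hg1
  obtain ⟨hN2, hN3⟩ := log_one_div_bounds hN0 hN1
  set L₁ := max 1 (Real.log (1 / ε))
  set L₂ := 1 + Real.log (1 / g)
  set L₃ := 1 + Real.log (1 / N)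
  set e := max 1 (1 / ε)
  have hL1 : 1 ≤ L₁ := le_max_left _ _
  have hL2 : 1 ≤ L₂ := by simp only [L₂]; linarith
  have hL3 : 1 ≤ L₃ := by simp only [L₃]; linarith
  have he : 1 ≤ e := le_max_left _ _
  have hL1e : L₁ ≤ e := max_le_max le_rfl
    ((Real.log_le_sub_one_of_pos (by positivity)).trans (by linarith))
  have hloge : Real.log e ≤ L₁ := by
    rcases max_cases 1 (1 / ε) with ⟨h, _⟩ | ⟨h, _⟩
    · simp only [e]; rw [h, Real.log_one]; linarith
    · simp only [e]; rw [h]; exact le_max_right _ _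
  have hg4 : 1 ≤ 1 / g := by rwa [le_div_iff₀ hg0, one_mul]
  have hN4 : 1 ≤ 1 / N := by rwa [le_div_iff₀ hN0, one_mul]
  set Y := e * (1 / g) * (1 / N)
  have hY : 1 ≤ Y := one_le_mul_of_one_le_of_one_le (one_le_mul_of_one_le_of_one_le he hg4) hN4
  have hY1 : 1 / N ≤ Y := le_mul_of_one_le_left (by positivity)
    (one_le_mul_of_one_le_of_one_le he hg4)
  have hRY : R ≤ c * Y ^ 8 := by
    have h1 : L₁ ^ 2 / ε ^ 2 ≤ e ^ 8 := by
      have h2 : L₁ ^ 2 / ε ^ 2 = L₁ ^ 2 * (1 / ε) ^ 2 := by ring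
      rw [h2]
      calc L₁ ^ 2 * (1 / ε) ^ 2 ≤ e ^ 2 * e ^ 2 := by
            gcongr
            exact le_max_right _ _
        _ = e ^ 4 := by ring
        _ ≤ e ^ 8 := pow_le_pow_right₀ he (by norm_num)
    have h2 : L₂ ^ 3 / g ^ 5 ≤ (1 / g) ^ 8 := by
      calc L₂ ^ 3 / g ^ 5 = L₂ ^ 3 * (1 / g) ^ 5 := by ring
        _ ≤ (1 / g) ^ 3 * (1 / g) ^ 5 := by gcongr
        _ = _ := by ring
    have h3 : L₃ ^ 3 / N ≤ (1 / N) ^ 8 := by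
      calc L₃ ^ 3 / N = L₃ ^ 3 * (1 / N) := by ring
        _ ≤ (1 / N) ^ 3 * (1 / N) := by gcongr
        _ = (1 / N) ^ 4 := by ring
        _ ≤ (1 / N) ^ 8 := pow_le_pow_right₀ hN4 (by norm_num)
    calc R ≤ c * (L₁ ^ 2 / ε ^ 2) * (L₂ ^ 3 / g ^ 5) * (L₃ ^ 3 / N) := hR
      _ ≤ c * e ^ 8 * (1 / g) ^ 8 * (1 / N) ^ 8 := by gcongr
      _ = c * Y ^ 8 := by ring
  have hY8 : Y ≤ Y ^ 8 := le_self_pow₀ hY (by norm_num)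
  have hcY : Y ^ 8 ≤ c * Y ^ 8 := le_mul_of_one_le_left (by positivity) hc
  have hle : 2 * (R + 1) * (1 / N + R) ≤ 8 * c ^ 2 * Y ^ 16 := by
    calc 2 * (R + 1) * (1 / N + R) ≤ 2 * (2 * (c * Y ^ 8)) * (2 * (c * Y ^ 8)) := by
          gcongr <;> linarith
      _ = _ := by ring
  have hc0 : 0 < c := by linarith
  have hY0 : 0 < Y := by linarith
  refine (Real.log_le_log (by positivity) hle).trans ?_
  rw [Real.log_mul (by positivity) (by positivity), Real.log_mul (by norm_num) (by positivity),
    Real.log_pow, Real.log_pow]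
  have h8 : Real.log 8 = 3 * Real.log 2 := by
    rw [show (8 : ℝ) = 2 ^ 3 by norm_num, Real.log_pow]; norm_num
  have hlogY : Real.log Y = Real.log e + Real.log (1 / g) + Real.log (1 / N) := by
    simp only [Y]
    rw [Real.log_mul (by positivity) (by positivity), Real.log_mul (by positivity) (by positivity)]
  have h12 : L₁ + L₂ - 1 ≤ L₁ * L₂ := add_sub_one_le_mul hL1 hL2
  have h12' : 1 ≤ L₁ * L₂ := one_le_mul_of_one_le_of_one_le hL1 hL2
  have h123 : L₁ * L₂ + L₃ - 1 ≤ L₁ * L₂ * L₃ := add_sub_one_le_mul h12' hL3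
  have hL : 1 ≤ L₁ * L₂ * L₃ := one_le_mul_of_one_le_of_one_le h12' hL3
  have hYL : Real.log Y ≤ L₁ * L₂ * L₃ := by
    rw [hlogY]
    have : L₂ - 1 = Real.log (1 / g) := by simp [L₂]
    have : L₃ - 1 = Real.log (1 / N) := by simp [L₃]
    linarith
  have hlogc := Real.log_nonneg hc
  have hcL : 2 * Real.log c ≤ 2 * Real.log c * (L₁ * L₂ * L₃) :=
    le_mul_of_one_le_right (by positivity) hL
  rw [h8]
  push_cast
  linarith [Real.log_two_lt_d9]

/-- The stepsize, the number `k` of phases, the number `m` of blocks in a phase and the mixing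
exponent `j`. -/
theorem exists_parameters (T : ℕ) {b : ℝ} (hb : 1 ≤ b) :
    ∃ C : ℝ, 0 < C ∧ ∀ ε g N : ℝ, 0 < ε → 0 < g → g < 1 → 0 < N → N ≤ 1 → ε * g ≤ 2 * b →
      ∃ l : ℝ, 0 < l ∧ ε ^ 2 * g ^ 4 / (8 * l) < 1 ∧ ∃ j m k : ℕ,
        (1 / 2 : ℝ) ^ j ≤ N / 2 ∧
        1 / N * (1 - ε ^ 2 * g ^ 4 / (8 * l) * (N / 2)) ^ m ≤ g / 2 ∧
        2 * b / g * (1 - g / 2) ^ k ≤ ε / 2 ∧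
        Real.log (2 * ((k * (m * (T * j + 1 + 1)) : ℕ) + 1) *
          (1 / N + (k * (m * (T * j + 1 + 1)) : ℕ))) ≤ l ∧
        ((k * (m * (T * j + 1 + 1)) : ℕ) : ℝ) ≤
          C * ((max 1 (Real.log (1 / ε))) ^ 2 / ε ^ 2)
            * ((1 + Real.log (1 / g)) ^ 3 / g ^ 5) * ((1 + Real.log (1 / N)) ^ 3 / N) := by
  have hb4 : 1 ≤ Real.log (4 * b) := by
    have h2 : Real.log 4 = 2 * Real.log 2 := by
      rw [show (4 : ℝ) = 2 ^ 2 by norm_num, Real.log_pow]; norm_num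
    have := Real.log_le_log (by norm_num : (0 : ℝ) < 4) (by linarith : 4 ≤ 4 * b)
    linarith [Real.log_two_gt_d9]
  set b₄ := Real.log (4 * b)
  set c₁ : ℝ := 12 * (b₄ + 2) * (3 * T + 2) with hc₁
  have hT : (0 : ℝ) ≤ T := Nat.cast_nonneg T
  have hc₁1 : 1 ≤ c₁ := by
    exact one_le_mul_of_one_le_of_one_le (by linarith) (by linarith)
  have hlogc₁ : 0 ≤ Real.log (8 * c₁) := Real.log_nonneg (by linarith)
  -- The number of steps is proportional to `c₀` itself, so `c₀` must exceed `19 + 2 log(8 c₁ c₀)`;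
  -- as `log c₀ ≤ c₀ / 4 + 1`, the first summand ensures this. The summand `b ^ 2` makes `α < 1`.
  set c₀ : ℝ := 2 * (21 + 2 * Real.log (8 * c₁)) + b ^ 2 with hc₀
  have hc₀b : b ^ 2 ≤ c₀ := by linarith
  have hc₀1 : 1 ≤ c₀ := by linarith [sq_nonneg b]
  have hlogc₀ : 19 + 2 * Real.log (8 * c₁ * c₀) ≤ c₀ := by
    rw [Real.log_mul (by positivity) (by positivity)]
    have := log_le_quarter_add_one (show 0 < c₀ by linarith)
    linarith [sq_nonneg b]
  refine ⟨8 * c₁ * c₀, by positivity, fun ε g N hε hg0 hg1 hN0 hN1 hεg => ?_⟩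
  obtain ⟨hg2, hg3⟩ := log_one_div_bounds hg0 hg1.le
  obtain ⟨hN2, hN3⟩ := log_one_div_bounds hN0 hN1
  set L₁ := max 1 (Real.log (1 / ε)) with hL₁
  set L₂ := 1 + Real.log (1 / g) with hL₂
  set L₃ := 1 + Real.log (1 / N) with hL₃
  have hL1 : 1 ≤ L₁ := le_max_left _ _
  have hL1' : Real.log (1 / ε) ≤ L₁ := le_max_right _ _
  have hL2 : 1 ≤ L₂ := by linarith
  have hL3 : 1 ≤ L₃ := by linarith
  have h12 : L₁ + L₂ - 1 ≤ L₁ * L₂ := add_sub_one_le_mul hL1 hL2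
  have h12' : 1 ≤ L₁ * L₂ := one_le_mul_of_one_le_of_one_le hL1 hL2
  have hL : 1 ≤ L₁ * L₂ * L₃ := one_le_mul_of_one_le_of_one_le h12' hL3
  set l := c₀ * (L₁ * L₂ * L₃) with hl
  have hlc : c₀ ≤ l := le_mul_of_one_le_right (by linarith) hL
  have hl0 : 0 < l := by linarith
  set α := ε ^ 2 * g ^ 4 / (8 * l) with hα
  have hα0 : 0 < α := by positivity
  have hα1 : α < 1 := by
    rw [hα, div_lt_one (by positivity)]
    calc ε ^ 2 * g ^ 4 = (ε * g) ^ 2 * g ^ 2 := by ring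
      _ ≤ (2 * b) ^ 2 * 1 := by
          gcongr
          exact pow_le_one₀ hg0.le hg1.le
      _ = 4 * b ^ 2 := by ring
      _ < 8 * l := by linarith
  obtain ⟨j, hj, hj'⟩ := exists_half_pow_le hN0 hN1
  have hαN : α * (N / 2) ≤ 1 := mul_le_one₀ hα1.le (by positivity) (by linarith)
  have hN4 : 1 ≤ 1 / N := by rwa [le_div_iff₀ hN0, one_mul]
  obtain ⟨m, hm, hm'⟩ := exists_mul_one_sub_pow_le (a := 1 / N) (x := α * (N / 2)) (d := g / 2)
    (by positivity) (by positivity) hαN (by positivity) (by linarith)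
  have hbg : ε / 2 ≤ 2 * b / g := by
    rw [le_div_iff₀ hg0]; linarith
  obtain ⟨k, hk, hk'⟩ := exists_mul_one_sub_pow_le (a := 2 * b / g) (x := g / 2) (d := ε / 2)
    (by positivity) (by positivity) (by linarith) (by positivity) hbg
  have hm2 : (m : ℝ) ≤ 4 * (L₂ * L₃) / (α * N) := by
    refine hm'.trans ?_
    have e1 : Real.log (1 / N / (g / 2)) = Real.log 2 + Real.log (1 / N) + Real.log (1 / g) := by
      rw [← Real.log_mul (by norm_num) (by positivity),
        ← Real.log_mul (by positivity) (by positivity)]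
      congr 1
      field_simp
    have e2 : 1 + Real.log (1 / N / (g / 2)) ≤ 2 * (L₂ * L₃) := by
      have : L₂ + L₃ - 1 ≤ L₂ * L₃ := add_sub_one_le_mul hL2 hL3
      rw [e1]
      linarith [Real.log_two_lt_d9]
    calc (1 + Real.log (1 / N / (g / 2))) / (α * (N / 2)) ≤
          2 * (L₂ * L₃) / (α * (N / 2)) := by gcongr
      _ = _ := by field_simp; ring
  have hk2 : (k : ℝ) ≤ (b₄ + 2) * (2 * (L₁ * L₂)) / g := by
    refine hk'.trans ?_
    have e1 : Real.log (2 * b / g / (ε / 2)) = b₄ + Real.log (1 / ε) + Real.log (1 / g) := by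
      simp only [b₄]
      rw [← Real.log_mul (by positivity) (by positivity),
        ← Real.log_mul (by positivity) (by positivity)]
      congr 1
      field_simp
      ring
    have e2 : 1 + Real.log (2 * b / g / (ε / 2)) ≤ (b₄ + 2) * (L₁ * L₂) := by
      have : b₄ ≤ b₄ * (L₁ * L₂) := le_mul_of_one_le_right (by linarith) h12'
      rw [e1]
      linarith
    calc (1 + Real.log (2 * b / g / (ε / 2))) / (g / 2) ≤
          (b₄ + 2) * (L₁ * L₂) / (g / 2) := by gcongr
      _ = _ := by field_simp
  have hj2 : (T * j + 1 + 1 : ℝ) ≤ (3 * T + 2) * L₃ := by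
    have := mul_le_mul_of_nonneg_left hj' hT
    linarith
  have hK : ((k * (m * (T * j + 1 + 1)) : ℕ) : ℝ) ≤
      8 * c₁ * c₀ * (L₁ ^ 2 / ε ^ 2) * (L₂ ^ 3 / g ^ 5) * (L₃ ^ 3 / N) := by
    -- Here `k ≲ L₁ L₂ / g`, `m ≲ L₂ L₃ / (α N)` with `1 / α = 8 c₀ L₁ L₂ L₃ / (ε² g⁴)`, and a block
    -- has length `≲ L₃`: this produces the powers `L₁ ^ 2`, `L₂ ^ 3`, `L₃ ^ 3` and `g ^ 5`.
    push_cast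
    calc (k : ℝ) * (m * (T * j + 1 + 1)) ≤ (b₄ + 2) * (2 * (L₁ * L₂)) / g *
          (4 * (L₂ * L₃) / (α * N) * ((3 * T + 2) * L₃)) := by gcongr
      _ = 2 / 3 * (8 * c₁ * c₀ * (L₁ ^ 2 / ε ^ 2) * (L₂ ^ 3 / g ^ 5) * (L₃ ^ 3 / N)) := by
          rw [hα, hl, hc₁]
          field_simp
          ring
      _ ≤ _ := by
          have : 0 ≤ 8 * c₁ * c₀ * (L₁ ^ 2 / ε ^ 2) * (L₂ ^ 3 / g ^ 5) * (L₃ ^ 3 / N) := by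
            positivity
          linarith
  refine ⟨l, hl0, hα1, j, m, k, hj, hm, hk, ?_, hK⟩
  refine (log_union_le hε hg0 hg1.le hN0 hN1 (c := 8 * c₁ * c₀) ?_ (Nat.cast_nonneg _)
    hK).trans ?_
  · exact one_le_mul_of_one_le_of_one_le (by linarith) hc₀1
  · exact mul_le_mul_of_nonneg_right hlogc₀ (by linarith)

end Parameters

/-! ### Sample complexity -/

section SampleComplexity

variable {S A : Type*} [Fintype S] [Fintype A]

theorem minVisit_pos [Nonempty S] [Nonempty A] {κ : S → ℝ} {π : S → A → ℝ} (hκ : ∀ s, 0 < κ s)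
    (hπ : ∀ s a, 0 < π s a) : 0 < minVisit κ π := by
  obtain ⟨x, hx⟩ := exists_eq_ciInf_of_finite (f := fun x : S × A => κ x.1 * π x.1 x.2)
  rw [minVisit, ← hx]
  exact mul_pos (hκ _) (hπ _ _)

theorem card_mul_minVisit_le {P : Matrix S S ℝ} {κ : S → ℝ} (hκ : IsStationary P κ)
    (π : Policy S A) : Fintype.card (S × A) * minVisit κ π ≤ 1 := by
  have h := Finset.sum_le_sum fun x (_ : x ∈ (Finset.univ : Finset (S × A))) => minVisit_le κ π x
  rw [Finset.sum_const, Finset.card_univ, nsmul_eq_mul, Fintype.sum_prod_type] at h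
  simpa [← Finset.mul_sum, π.sum_eq_one, hκ.sum_eq_one] using h

variable [Nonempty S] [Nonempty A]

theorem MDP.IsBellmanOptimal.norm_le {M : MDP S A} {Q : S × A → ℝ} (hQ : M.IsBellmanOptimal Q) :
    ‖Q‖ ≤ 1 / (1 - M.γ) :=
  (pi_norm_le_iff_of_nonempty _).2 fun x =>
    abs_le.2 ⟨by linarith [(hQ.nonneg_and_le x).1, (hQ.nonneg_and_le x).2], (hQ.nonneg_and_le x).2⟩

variable [DecidableEq S] [DecidableEq A]

theorem MDP.norm_qIterate_sub_le_two_mul {M : MDP S A} {Q₀ Qs : S × A → ℝ}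
    (hQs : M.IsBellmanOptimal Qs) {α b : ℝ} (hα0 : 0 ≤ α) (hα1 : α ≤ 1) (hb : 1 ≤ b)
    (hQ₀ : ‖Q₀‖ ≤ b / (1 - M.γ)) (z : ℕ → S × A) (n : ℕ) :
    ‖M.qIterate (fun _ => α) Q₀ z n - Qs‖ ≤ 2 * b / (1 - M.γ) := by
  have hγ : 0 < 1 - M.γ := sub_pos.2 M.γ_lt_one
  have hb' : 1 / (1 - M.γ) ≤ b / (1 - M.γ) := by gcongr
  have h1 := M.norm_qIterate_le hα0 hα1 hb' hQ₀ z n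
  have h2 := norm_sub_le (M.qIterate (fun _ => α) Q₀ z n) Qs
  have h3 := hQs.norm_le
  rw [mul_div_assoc]
  linarith

variable {Ω : Type*} [MeasurableSpace S] [MeasurableSpace A]
  [DiscreteMeasurableSpace S] [DiscreteMeasurableSpace A] [MeasurableSpace Ω]
  {M : MDP S A} {π : Policy S A} {μ : Measure Ω} [IsProbabilityMeasure μ] {Z : ℕ → Ω → S × A}

theorem IsTrajectory.integral_norm_qIterate_sub_le_of_parameters (hZ : IsTrajectory M π μ Z)
    (hirr : (M.stateChain π).IsIrreducible) (hap : IsAperiodic (M.stateChain π)) {κ : S → ℝ}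
    (hκ : IsStationary (M.stateChain π) κ) {T : ℕ}
    (hT : mixingTime (M.stateChain π) κ (1 / 4) ≤ T) (hN0 : 0 < minVisit κ π)
    {Q₀ Qs : S × A → ℝ} (hQs : M.IsBellmanOptimal Qs) {b ε l : ℝ} (hb : 1 ≤ b) (hε : 0 < ε)
    (hl0 : 0 < l) (hQ₀ : ‖Q₀‖ ≤ b / (1 - M.γ)) {α : ℝ}
    (hα : α = ε ^ 2 * (1 - M.γ) ^ 4 / (8 * l)) (hα1 : α < 1) {j m k : ℕ}
    (hj : (1 / 2 : ℝ) ^ j ≤ minVisit κ π / 2)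
    (hm : 1 / minVisit κ π * (1 - α * (minVisit κ π / 2)) ^ m ≤ (1 - M.γ) / 2)
    (hk : 2 * b / (1 - M.γ) * (1 - (1 - M.γ) / 2) ^ k ≤ ε / 2) {K : ℕ}
    (hK : K = k * (m * (T * j + 1 + 1)))
    (hlog : Real.log (2 * (K + 1) * (1 / minVisit κ π + K)) ≤ l) (t : ℕ) :
    ∫ ω, ‖M.qIterate (fun _ => α) Q₀ (fun i => Z i ω) (t + K) - Qs‖ ∂μ ≤ ε := by
  have hγ : 0 < 1 - M.γ := sub_pos.2 M.γ_lt_one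
  have hγ0 := M.γ_pos
  set N := minVisit κ π
  have hcardN := card_mul_minVisit_le hκ π
  -- The numbers `κ(s) π(a | s)` sum to one, which removes the size of the spaces from all bounds.
  have hcard : (Fintype.card (S × A) : ℝ) ≤ 1 / N := by rwa [le_div_iff₀ hN0]
  have hcard1 : (1 : ℝ) ≤ Fintype.card (S × A) := by exact_mod_cast Fintype.card_pos
  have hN1 : N ≤ 1 := (le_mul_of_one_le_left hN0.le hcard1).trans hcardN
  have hα0 : 0 < α := by rw [hα]; positivity
  have hαN : α * (N / 2) ≤ 1 := mul_le_one₀ hα1.le (by positivity) (by linarith)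
  -- `θ = 4 l / (ε g)` makes `2 l / (θ g) = ε / 2`, and `α` is then the value for which the
  -- Hoeffding condition is an equality.
  have hθl : (4 * l / (ε * (1 - M.γ))) ^ 2 * α * (1 / (1 - M.γ)) ^ 2 / 2 ≤ l := by
    refine le_of_eq ?_
    rw [hα]
    field_simp
    norm_num
  have hD := M.norm_qIterate_sub_le_two_mul (Q₀ := Q₀) hQs hα0.le hα1.le hb hQ₀
  have hmain := hZ.integral_norm_qIterate_sub_le hQs hα0 hα1.le
    (θ := 4 * l / (ε * (1 - M.γ))) (by positivity) hl0.le hθl (t := t) (K := K)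
    (fun z => hD z t)
  have hu := hZ.integral_norm_errorBound_le hα0.le hα1.le
    (show 0 ≤ 2 * b / (1 - M.γ) by positivity)
    (fun x y => M.minVisit_le_iterate_indicator hirr hap hκ hT hj x y) hαN t m k
  rw [← hK] at hu
  have hfac : Fintype.card (S × A) * (1 - α * (N / 2)) ^ m + M.γ ≤ 1 - (1 - M.γ) / 2 := by
    have := mul_le_mul_of_nonneg_right hcard (pow_nonneg (sub_nonneg.2 hαN) m)
    linarith
  have hfac0 : 0 ≤ Fintype.card (S × A) * (1 - α * (N / 2)) ^ m + M.γ :=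
    add_nonneg (mul_nonneg (Nat.cast_nonneg _) (pow_nonneg (sub_nonneg.2 hαN) m)) hγ0.le
  have hu2 : ∫ ω, ‖errorBound α M.γ (2 * b / (1 - M.γ)) t (fun i => Z i ω) K‖ ∂μ ≤ ε / 2 := by
    refine hu.trans (le_trans ?_ hk)
    rw [mul_comm]
    gcongr
  have hlog2 : Real.log (2 * (K + 1) * (Fintype.card (S × A) + K)) ≤ l := by
    refine (Real.log_le_log (by positivity) ?_).trans hlog
    gcongr
  have hnoise : (l + Real.log (2 * (K + 1) * (Fintype.card (S × A) + K))) /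
      (4 * l / (ε * (1 - M.γ)) * (1 - M.γ)) ≤ ε / 2 := by
    rw [div_le_iff₀ (by positivity)]
    have : ε / 2 * (4 * l / (ε * (1 - M.γ)) * (1 - M.γ)) = 2 * l := by
      field_simp
      norm_num
    rw [this]
    linarith
  linarith

end SampleComplexity

end QLearning

end

/-! ### The sample complexity theorem -/

open QLearning in
theorem corollary3p1 :
    ∃ m : ℕ, ∀ (T : ℕ) (B : ℝ), ∃ C : ℝ, 0 < C ∧
      ∀ (S A : Type*) [Fintype S] [DecidableEq S] [Nonempty S]
        [MeasurableSpace S] [DiscreteMeasurableSpace S]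
        [Fintype A] [DecidableEq A] [Nonempty A]
        [MeasurableSpace A] [DiscreteMeasurableSpace A]
        (M : MDP S A) (πb : Policy S A),
        (∀ s a, 0 < πb s a) →
        (M.stateChain πb).IsIrreducible →
        IsAperiodic (M.stateChain πb) →
        (∃! κ : S → ℝ, IsStationary (M.stateChain πb) κ) ∧
        (∃! Qs : S × A → ℝ, M.IsOptimalQ Qs) ∧
        ∀ κ : S → ℝ, IsStationary (M.stateChain πb) κ →
        mixingTime (M.stateChain πb) κ (1 / 4) ≤ T →
        ∀ Qs : S × A → ℝ, M.IsOptimalQ Qs →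
        ∀ Nmin : ℝ, Nmin = minVisit κ πb →
          0 < Nmin ∧
          ∀ ε : ℝ, 0 < ε →
          ∃ α : ℝ, 0 < α ∧ α < 1 ∧
          ∀ Q₀ : S × A → ℝ, ‖Q₀‖ ≤ B / (1 - M.γ) →
          ∀ (Ω : Type*) [MeasurableSpace Ω] (μ : MeasureTheory.Measure Ω)
            [MeasureTheory.IsProbabilityMeasure μ] (Z : ℕ → Ω → S × A),
            IsTrajectory M πb μ Z →
          ∀ k : ℕ,
            C * ((max 1 (Real.log (1 / ε))) ^ 2 / ε ^ 2)
              * ((1 + Real.log (1 / (1 - M.γ))) ^ m / (1 - M.γ) ^ 5)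
              * ((1 + Real.log (1 / Nmin)) ^ m / Nmin ^ 3) ≤ (k : ℝ) →
            ∫ ω, ‖M.qIterate (fun _ => α) Q₀ (fun i => Z i ω) k - Qs‖ ∂μ ≤ ε := by
  refine ⟨3, fun T B => ?_⟩
  -- `B` may be less than one, even negative; `max B 1` gives a ball that also contains `Q*`.
  obtain ⟨C, hC, hpar⟩ := exists_parameters T (le_max_right B 1)
  refine ⟨C, hC, ?_⟩
  intro S A _ _ _ _ _ _ _ _ _ _ M πb hπ hirr hap
  obtain ⟨Q, hQ⟩ := M.exists_isBellmanOptimal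
  refine ⟨existsUnique_isStationary (M.isStochastic_stateChain πb) hirr hap,
    ⟨Q, (M.isOptimalQ_iff hQ Q).2 rfl, fun Q' => (M.isOptimalQ_iff hQ Q').1⟩, ?_⟩
  intro κ hκ hT Qs hQs Nmin hNmin
  obtain rfl := (M.isOptimalQ_iff hQ Qs).1 hQs
  have hN0 : 0 < Nmin := hNmin ▸ minVisit_pos (fun s => hκ.pos hirr hap s) hπ
  refine ⟨hN0, fun ε hε => ?_⟩
  have hγ : 0 < 1 - M.γ := sub_pos.2 M.γ_lt_one
  have hγ1 : 1 - M.γ < 1 := by linarith [M.γ_pos]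
  have hcard1 : (1 : ℝ) ≤ Fintype.card (S × A) := by exact_mod_cast Fintype.card_pos
  have hN1 : Nmin ≤ 1 := (le_mul_of_one_le_left hN0.le hcard1).trans
    (hNmin ▸ card_mul_minVisit_le hκ πb)
  have hB : B / (1 - M.γ) ≤ max B 1 / (1 - M.γ) := by gcongr; exact le_max_left _ _
  -- Otherwise the a priori bound `2 max(B, 1) / (1 - γ)` on the error is already below `ε`, and any
  -- stepsize will do.
  by_cases hsmall : ε * (1 - M.γ) ≤ 2 * max B 1
  · obtain ⟨l, hl0, hα1, j, m, k', hj, hm, hk', hlog, hK⟩ :=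
      hpar ε (1 - M.γ) Nmin hε hγ hγ1 hN0 hN1 hsmall
    refine ⟨_, by positivity, hα1, fun Q₀ hQ₀ Ω _ μ _ Z hZ k hk => ?_⟩
    -- Surplus samples are spent before the analysis starts: the bound is uniform in the starting
    -- time `t`.
    obtain ⟨t, rfl⟩ : ∃ t, k = t + k' * (m * (T * j + 1 + 1)) := by
      refine Nat.exists_eq_add_of_le' ?_
      have hN3 : (1 + Real.log (1 / Nmin)) ^ 3 / Nmin ≤
          (1 + Real.log (1 / Nmin)) ^ 3 / Nmin ^ 3 := by
        have := (log_one_div_bounds hN0 hN1).1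
        gcongr
        exact pow_le_of_le_one hN0.le hN1 (by norm_num)
      have := (log_one_div_bounds hγ hγ1.le).1
      exact_mod_cast hK.trans ((mul_le_mul_of_nonneg_left hN3 (by positivity)).trans hk)
    subst hNmin
    exact hZ.integral_norm_qIterate_sub_le_of_parameters hirr hap hκ hT hN0 hQ (le_max_right B 1)
      hε hl0 (hQ₀.trans hB) rfl hα1 hj hm hk' rfl hlog t
  · refine ⟨1 / 2, by norm_num, by norm_num, fun Q₀ hQ₀ Ω _ μ _ Z hZ k _ => ?_⟩
    have hle : ∀ z, ‖M.qIterate (fun _ => 1 / 2) Q₀ z k - Qs‖ ≤ ε := fun z => by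
      refine (M.norm_qIterate_sub_le_two_mul hQ (by norm_num) (by norm_num) (le_max_right B 1)
        (hQ₀.trans hB) z k).trans ?_
      rw [div_le_iff₀ hγ]
      exact (not_le.1 hsmall).le
    calc _ ≤ ∫ _, ε ∂μ := integral_mono_of_nonneg
          (Filter.Eventually.of_forall fun ω => norm_nonneg _) (integrable_const ε)
          (Filter.Eventually.of_forall fun ω => hle fun i => Z i ω)
      _ = ε := by simp
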